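/- Let $n>p$ be integers, and let $f(\cdot\,;\theta)$, $\theta\ge 0$, be probability densities on $\mathbb{R}^p$ with $f(x;0)=(2\pi)^{-p/2}\exp(-\|x\|^2/2)$. For $a\in\mathbb{R}^p$ and a nonsingular $p\times p$ matrix $B$ put $f_{a,B}(x;\theta)=|\det B|^{-1}f(B^{-1}(x-a);\theta)$, and let $x_1,\dots,x_n$ be i.i.d. with density $f_{a,B}(\cdot\,;\theta)$. Let $LT(p)$ be the group of lower triangular $p\times p$ matrices with positive diagonal; $\mathbb{R}^p\times LT(p)$ acts on samples by $x_i\mapsto a+Tx_i$. Let $\bar x=\frac1n\sum_i x_i$, $S=\frac1n\sum_i(x_i-\bar x)(x_i-\bar x)'$, and, when $S$ is nonsingular (almost surely), let $T_S\in LT(p)$ be its Cholesky root, $S=T_ST_S'$, and $z_i=T_S^{-1}(x_i-\bar x)$. Fix $\theta_1>0$ and put $$\Lambda(z)=\frac{\int_{LT(p)}\int_{\mathbb{R}^p}\prod_{i=1}^n f(a+Tz_i;\theta_1)\,da\,\prod_{i=1}^p t_{ii}^{\,n-i-1}\prod_{i\ge j}dt_{ij}}{\int_{LT(p)}\int_{\mathbb{R}^p}\prod_{i=1}^n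 f(a+Tz_i;0)\,da\,\prod_{i=1}^p t_{ii}^{\,n-i-1}\prod_{i\ge j}dt_{ij}} .$$ Consider testing $H_0:\theta=0$ ($a\in\mathbb{R}^p$ and nonsingular $B$ arbitrary) against $H_1:\theta=\theta_1$, with $a\in\mathbb{R}^p$ arbitrary and $B\in LT(p)$ arbitrary; if $f(x;\theta_1)$ is a function of $\|x\|^2$, then $B$ is an arbitrary nonsingular matrix under $H_1$ too. A test (a measurable function of the sample with values in $[0,1]$, the probability of rejection) of level $\alpha$ (rejection probability at most $\alpha$ everywhere on $H_0$) that is invariant under $\mathbb{R}^p\times LT(p)$ is most powerful invariant if at every parameter point of $H_1$ its power is at least that of every other invariant test of level $\alpha$. Then: (1) For every $k'>0$ the critical region $\{\Lambda(z)>k'\}$ is invariant, its probability $\alpha$ under $H_0$ does not depend on $(a,B)$, it is most powerful invariant of level $\alpha$, and every most powerful invariant test of level $\alpha$ equals its indicator almost everywhere. (2) For every $\alpha\in(0,1)$ there are $k'\ge0$, with $k'>0$ if $f(\cdot\,;\theta_1)$ is everywhere positive, and $\gamma\in[0,1]$ such that the test that rejects when $\Lambda(z)>k'$, rejects with probability $\gamma$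 when $\Lambda(z)=k'$, and accepts otherwise has rejection probability exactly $\alpha$ on $H_0$ and is most powerful invariant of level $\alpha$; every most powerful invariant test of level $\alpha$ agrees with it almost everywhere off $\{\Lambda(z)=k'\}$. If $\{\Lambda(z)=k'\}$ has probability $0$ under $H_0$, then the critical region $\{\Lambda(z)>k'\}$ has size exactly $\alpha$. -/

import Mathlib

open MeasureTheory
open scoped Matrix ENNReal

noncomputable section

namespace NormTest

/-- `g` is a probability density on `ℝ^p` with respect to Lebesgue measure. -/
structure IsDensity {p : ℕ} (g : (Fin p → ℝ) → ℝ) : Prop where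
  measurable : Measurable g
  nonneg : ∀ x, 0 ≤ g x
  lintegral_eq_one : ∫⁻ x, ENNReal.ofReal (g x) = 1

/-- The standard normal density `(2π)^{-p/2} exp(-‖x‖²/2)` on `ℝ^p`; `x ⬝ᵥ x = ∑ⱼ xⱼ²` is the
squared Euclidean norm. -/
def stdNormalDensity {p : ℕ} (x : Fin p → ℝ) : ℝ :=
  (2 * Real.pi) ^ (-(p : ℝ) / 2) * Real.exp (-(x ⬝ᵥ x) / 2)

/-- `f_{a,B}(x) = |det B|⁻¹ f(B⁻¹(x - a))`. -/
def affineDensity {p : ℕ} (g : (Fin p → ℝ) → ℝ) (a : Fin p → ℝ) (B : Matrix (Fin p) (Fin p) ℝ)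
    (x : Fin p → ℝ) : ℝ :=
  1 / |B.det| * g (B⁻¹ *ᵥ (x - a))

/-- The joint law of `n` i.i.d. observations `x₁, …, xₙ ∈ ℝ^p` with density `f_{a,B}`. -/
def sampleLaw (n : ℕ) {p : ℕ} (g : (Fin p → ℝ) → ℝ) (a : Fin p → ℝ)
    (B : Matrix (Fin p) (Fin p) ℝ) : Measure (Fin n → Fin p → ℝ) :=
  Measure.pi fun _ =>
    (volume : Measure (Fin p → ℝ)).withDensity fun x => ENNReal.ofReal (affineDensity g a B x)

/-- `LT(p)`: lower triangular `p × p` matrices with positive diagonal. -/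
def LT (p : ℕ) : Set (Matrix (Fin p) (Fin p) ℝ) :=
  {T | (∀ i j, i < j → T i j = 0) ∧ ∀ i, 0 < T i i}

/-- The action `(a, B) X = 1ₙ a' + X B'`, i.e. `xᵢ ↦ a + B xᵢ`, where `xᵢ = X i` is the `i`-th row
of the data matrix `X`. -/
def act {n p : ℕ} (a : Fin p → ℝ) (B : Matrix (Fin p) (Fin p) ℝ) (X : Fin n → Fin p → ℝ) :
    Fin n → Fin p → ℝ :=
  fun i => a + B *ᵥ X i

/-- The sample mean vector. -/
def sampleMean {n p : ℕ} (X : Fin n → Fin p → ℝ) : Fin p → ℝ :=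
  (n : ℝ)⁻¹ • ∑ i, X i

/-- The sample covariance matrix `S = n⁻¹ ∑ᵢ (xᵢ - x̄)(xᵢ - x̄)'`. -/
def sampleCov {n p : ℕ} (X : Fin n → Fin p → ℝ) : Matrix (Fin p) (Fin p) ℝ :=
  (n : ℝ)⁻¹ • ∑ i, Matrix.vecMulVec (X i - sampleMean X) (X i - sampleMean X)

/-- `zᵢ = T⁻¹ (xᵢ - x̄)`. -/
def standardize {n p : ℕ} (T : Matrix (Fin p) (Fin p) ℝ) (X : Fin n → Fin p → ℝ) :
    Fin n → Fin p → ℝ :=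
  fun i => T⁻¹ *ᵥ (X i - sampleMean X)

/-- Index set of the free entries `t_{ij}`, `i ≥ j`, of a lower triangular matrix. -/
abbrev LowerIdx (p : ℕ) : Type := {ij : Fin p × Fin p // ij.2 ≤ ij.1}

/-- The lower triangular matrix with the given entries on and below the diagonal. -/
def lowerMatrix {p : ℕ} (t : LowerIdx p → ℝ) : Matrix (Fin p) (Fin p) ℝ :=
  Matrix.of fun i j => if h : j ≤ i then t ⟨(i, j), h⟩ else 0

/-- `∫_{LT(p)} ∫_{ℝ^p} ∏ᵢ g(a + T zᵢ) da ∏ᵢ t_{ii}^{n-i-1} ∏_{i ≥ j} dt_{ij}`.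
The row index in the exponent runs over `1, …, p`, hence `i + 1` for `i : Fin p`. -/
def orbitIntegral {n p : ℕ} (g : (Fin p → ℝ) → ℝ) (z : Fin n → Fin p → ℝ) : ℝ≥0∞ :=
  ∫⁻ t in {t : LowerIdx p → ℝ | lowerMatrix t ∈ LT p},
    (∫⁻ a : Fin p → ℝ, ENNReal.ofReal (∏ i, g (a + lowerMatrix t *ᵥ z i))) *
      ENNReal.ofReal (∏ i : Fin p, lowerMatrix t i i ^ ((n : ℤ) - ((i : ℕ) + 1 : ℤ) - 1))

/-- The ratio of integrals, evaluated at `z`. -/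
def ratio {n p : ℕ} (g₁ g₀ : (Fin p → ℝ) → ℝ) (z : Fin n → Fin p → ℝ) : ℝ≥0∞ :=
  orbitIntegral g₁ z / orbitIntegral g₀ z

/-- The critical region `ratio(z) > k`, with `z` the data standardized by the Cholesky root
`T ∈ LT(p)`, `S = T T'`, of the sample covariance matrix. The (null) set of samples with singular
covariance matrix, where no such `T` exists, is not in the region. -/
def criticalRegion {n p : ℕ} (g₁ g₀ : (Fin p → ℝ) → ℝ) (k : ℝ) : Set (Fin n → Fin p → ℝ) :=
  {X | ∃ T ∈ LT p, sampleCov X = T * Tᵀ ∧ ENNReal.ofReal k < ratio g₁ g₀ (standardize T X)}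

/-- The boundary `ratio(z) = k` of the critical region. -/
def criticalBoundary {n p : ℕ} (g₁ g₀ : (Fin p → ℝ) → ℝ) (k : ℝ) : Set (Fin n → Fin p → ℝ) :=
  {X | ∃ T ∈ LT p, sampleCov X = T * Tᵀ ∧ ratio g₁ g₀ (standardize T X) = ENNReal.ofReal k}

/-- The test that rejects on `ratio > k`, rejects with probability `γ` on `ratio = k`, and accepts
otherwise. -/
def ratioTest {n p : ℕ} (g₁ g₀ : (Fin p → ℝ) → ℝ) (k γ : ℝ) (X : Fin n → Fin p → ℝ) : ℝ :=
  (criticalRegion g₁ g₀ k).indicator (fun _ => 1) X +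
    (criticalBoundary g₁ g₀ k).indicator (fun _ => γ) X

/-- A (possibly randomized) test, given by its rejection probability, that is invariant under the
action of `ℝ^p × LT(p)`. The indicator of an invariant critical region is a special case. -/
structure IsInvariantTest {n p : ℕ} (φ : (Fin n → Fin p → ℝ) → ℝ) : Prop where
  measurable : Measurable φ
  mem_Icc : ∀ X, φ X ∈ Set.Icc (0 : ℝ) 1
  invariant : ∀ (a : Fin p → ℝ), ∀ T ∈ LT p, ∀ X, φ (act a T X) = φ X

/-- `φ` has level `α` for the composite null hypothesis `{f_{a,B}(· ; 0) : a, B}`. -/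
def HasLevel {n p : ℕ} (g₀ : (Fin p → ℝ) → ℝ) (α : ℝ) (φ : (Fin n → Fin p → ℝ) → ℝ) : Prop :=
  ∀ (a : Fin p → ℝ) (B : Matrix (Fin p) (Fin p) ℝ), B.det ≠ 0 → ∫ X, φ X ∂(sampleLaw n g₀ a B) ≤ α

/-- `g(x)` is a function of `‖x‖²`. -/
def IsSpherical {p : ℕ} (g : (Fin p → ℝ) → ℝ) : Prop :=
  ∃ h : ℝ → ℝ, ∀ x, g x = h (x ⬝ᵥ x)

/-- The scale matrices `B` in the alternative: the group `LT(p)` for a general density, and all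
nonsingular matrices for a spherical one (when the group still acts transitively on the laws). -/
def altScales {p : ℕ} (g : (Fin p → ℝ) → ℝ) : Set (Matrix (Fin p) (Fin p) ℝ) :=
  {B | B.det ≠ 0 ∧ (B ∈ LT p ∨ IsSpherical g)}

/-- `φ` is a most powerful invariant test of level `α` for the null hypothesis `g₀` against the
alternative `g₁`. -/
structure IsMostPowerfulInvariant {n p : ℕ} (g₁ g₀ : (Fin p → ℝ) → ℝ) (α : ℝ)
    (φ : (Fin n → Fin p → ℝ) → ℝ) : Prop where
  isInvariantTest : IsInvariantTest φ
  hasLevel : HasLevel g₀ α φ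
  power_le : ∀ ψ : (Fin n → Fin p → ℝ) → ℝ, IsInvariantTest ψ → HasLevel g₀ α ψ →
    ∀ (a : Fin p → ℝ), ∀ B ∈ altScales g₁,
      ∫ X, ψ X ∂(sampleLaw n g₁ a B) ≤ ∫ X, φ X ∂(sampleLaw n g₁ a B)

end NormTest

end

noncomputable section

namespace NormTest

variable {n p : ℕ}

/-! The proof expresses the likelihood ratio of an invariant statistic by an average over the group
`G = ℝ^p ⋊ LT(p)`, without constructing a quotient space, and then applies the Neyman–Pearson lemma.

Let `I_g` be the orbit integral of the density `g`. Its weight is the Jacobian `det T ^ n` of the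
action on samples times the density of left Haar measure on `G`. Tonelli and the substitution `Y = a
+ T X` give, for invariant `φ` and any weight `w`, `∫ φ w I_g = ∫ φ(Y) ∏ g(y_i) W(Y) dY`, where
`W(Y)` is the left Haar integral of `w` over the points `h⁻¹Y`, `h ∈ G`
(`lintegral_mul_orbitIntegral`). For a suitable `w`, `W` is almost everywhere one constant in `(0,
∞)` (`exists_orbitAverage_averagingWeight`). Since the ratio `Λ = I_{g₁} / I_{g₀}` is itself
invariant, comparing the identity for `(φ Λ, g₀)` and for `(φ, g₁)` yields `E₁ φ = E₀[φ Λ]`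
(`lintegral_invariant_mul_ratio`).

Both hypotheses reduce to single laws: invariant tests have constant power along `G`, and a
spherical law depends on `B` only through `B Bᵀ = T Tᵀ`, with `T ∈ LT(p)` by Cholesky.
Neyman–Pearson for `Λ` (`neyman_pearson`) then gives optimality and uniqueness, and a quantile of
`Λ` gives every level. -/

/-! ### The group of lower triangular matrices and Cholesky roots. -/

lemma LT.lower {T : Matrix (Fin p) (Fin p) ℝ} (h : T ∈ LT p) : T.IsLowerTriangular :=
  fun i j hij => h.1 i j hij

lemma LT.det_eq {T : Matrix (Fin p) (Fin p) ℝ} (h : T ∈ LT p) : T.det = ∏ i, T i i :=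
  Matrix.det_of_isLowerTriangular T (LT.lower h)

lemma LT.det_pos {T : Matrix (Fin p) (Fin p) ℝ} (h : T ∈ LT p) : 0 < T.det := by
  rw [LT.det_eq h]
  exact Finset.prod_pos fun i _ => h.2 i

lemma LT.isUnit_det {T : Matrix (Fin p) (Fin p) ℝ} (h : T ∈ LT p) : IsUnit T.det :=
  (LT.det_pos h).ne'.isUnit

lemma mul_diag_of_lower {T U : Matrix (Fin p) (Fin p) ℝ} (hT : T.IsLowerTriangular)
    (hU : U.IsLowerTriangular) (i : Fin p) : (T * U) i i = T i i * U i i := by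
  rw [Matrix.mul_apply]
  refine Finset.sum_eq_single i (fun k _ hk => ?_) (by simp)
  rcases lt_or_gt_of_ne hk with h | h
  · rw [hU (show OrderDual.toDual i < OrderDual.toDual k from h), mul_zero]
  · rw [hT (show OrderDual.toDual k < OrderDual.toDual i from h), zero_mul]

lemma LT.one : (1 : Matrix (Fin p) (Fin p) ℝ) ∈ LT p :=
  ⟨fun _ _ hij => Matrix.one_apply_ne hij.ne, fun i => by simp⟩

lemma inv_lower {T : Matrix (Fin p) (Fin p) ℝ} (hT : T.IsLowerTriangular) (h : IsUnit T.det) :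
    T⁻¹.IsLowerTriangular := by
  have := Matrix.invertibleOfIsUnitDet T h
  exact Matrix.blockTriangular_inv_of_blockTriangular hT

lemma LT.inv {T : Matrix (Fin p) (Fin p) ℝ} (hT : T ∈ LT p) : T⁻¹ ∈ LT p := by
  have hl := inv_lower (LT.lower hT) (LT.isUnit_det hT)
  refine ⟨fun i j hij => hl hij, fun i => ?_⟩
  have h1 := mul_diag_of_lower hl (LT.lower hT) i
  rw [Matrix.nonsing_inv_mul _ (LT.isUnit_det hT), Matrix.one_apply_eq] at h1
  exact (pos_iff_pos_of_mul_pos (by rw [← h1]; exact one_pos)).2 (hT.2 i)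

/-- A positive definite matrix has a Cholesky root. -/
lemma exists_cholesky {S : Matrix (Fin p) (Fin p) ℝ} (hS : S.PosDef) :
    ∃ T ∈ LT p, S = T * Tᵀ := by
  set L := LDL.lower hS with hL
  have hinv : IsUnit (LDL.lowerInv hS).det :=
    (Matrix.isUnit_iff_isUnit_det _).1 (isUnit_of_invertible _)
  have hlow : L.IsLowerTriangular :=
    inv_lower (fun i j hij => LDL.lowerInv_triangular hS hij) hinv
  have hLu : IsUnit L.det := by
    rw [hL, LDL.lower]; exact Matrix.isUnit_nonsing_inv_det _ hinv
  have hLi : ∀ i, L i i ≠ 0 := by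
    intro i hi
    rw [Matrix.det_of_isLowerTriangular L hlow] at hLu
    exact hLu.ne_zero (Finset.prod_eq_zero (Finset.mem_univ i) hi)
  set d := LDL.diagEntries hS with hd
  have hLS : L * Matrix.diagonal d * Lᵀ = S := by
    have := LDL.lower_conj_diag hS
    rwa [Matrix.conjTranspose_eq_transpose_of_trivial] at this
  have hdpos : ∀ i, 0 < d i := by
    have h2 : (LDL.diag hS).PosDef := by
      rw [LDL.diag_eq_lowerInv_conj hS]
      refine hS.mul_mul_conjTranspose_same ?_
      exact Matrix.vecMul_injective_iff_isUnit.2 ((Matrix.isUnit_iff_isUnit_det _).2 hinv)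
    intro i
    have := h2.diag_pos (i := i)
    simpa [LDL.diag] using this
  -- The square root of `d i` takes the sign of `L i i`, so that scaling the columns of `L` gives
  -- the positive diagonal `|L i i| √(d i)`; only `L i i ≠ 0` has been established.
  set e : Fin p → ℝ := fun i => SignType.sign (L i i) * Real.sqrt (d i) with he
  have hee : ∀ i, e i * e i = d i := by
    intro i
    have h1 : ((SignType.sign (L i i) : ℝ)) * (SignType.sign (L i i) : ℝ) = 1 := by
      rcases lt_or_gt_of_ne (hLi i) with h | h
      · simp [sign_neg h]
      · simp [sign_pos h]
    calc e i * e i = ((SignType.sign (L i i) : ℝ) * (SignType.sign (L i i) : ℝ)) *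
          (Real.sqrt (d i) * Real.sqrt (d i)) := by simp only [he]; ring
      _ = d i := by rw [h1, one_mul, Real.mul_self_sqrt (hdpos i).le]
  refine ⟨L * Matrix.diagonal e, ⟨fun i j hij => ?_, fun i => ?_⟩, ?_⟩
  · rw [Matrix.mul_diagonal, hlow (show OrderDual.toDual j < OrderDual.toDual i from hij), zero_mul]
  · rw [Matrix.mul_diagonal]
    simp only [he]
    have h3 : 0 < Real.sqrt (d i) := Real.sqrt_pos.2 (hdpos i)
    have h4 : L i i * (SignType.sign (L i i) : ℝ) = |L i i| := self_mul_sign _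
    rw [← mul_assoc, h4]
    exact mul_pos (abs_pos.2 (hLi i)) h3
  · rw [Matrix.transpose_mul, Matrix.diagonal_transpose, Matrix.mul_assoc,
      ← Matrix.mul_assoc (Matrix.diagonal e), Matrix.diagonal_mul_diagonal]
    simp only [hee]
    rw [← Matrix.mul_assoc, hLS]

/-! ### Sample mean and covariance under the action -/

lemma sampleMean_act (hn : n ≠ 0) (a : Fin p → ℝ) (B : Matrix (Fin p) (Fin p) ℝ)
    (X : Fin n → Fin p → ℝ) : sampleMean (act a B X) = a + B *ᵥ sampleMean X := by
  have hn' : (n : ℝ) ≠ 0 := Nat.cast_ne_zero.2 hn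
  simp only [sampleMean, act, Finset.sum_add_distrib, Finset.sum_const, Finset.card_univ,
    Fintype.card_fin, smul_add, Matrix.mulVec_smul, Matrix.mulVec_sum]
  rw [← Nat.cast_smul_eq_nsmul ℝ, smul_smul, inv_mul_cancel₀ hn', one_smul]

lemma sampleCov_act (hn : n ≠ 0) (a : Fin p → ℝ) (B : Matrix (Fin p) (Fin p) ℝ)
    (X : Fin n → Fin p → ℝ) : sampleCov (act a B X) = B * sampleCov X * Bᵀ := by
  have h : ∀ i, act a B X i - sampleMean (act a B X) = B *ᵥ (X i - sampleMean X) := by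
    intro i
    rw [sampleMean_act hn, Matrix.mulVec_sub]
    simp [act]
  simp only [sampleCov, h, Matrix.mul_smul, Matrix.smul_mul, Matrix.mul_sum, Matrix.sum_mul]
  congr 1
  refine Finset.sum_congr rfl fun i _ => ?_
  rw [Matrix.mul_vecMulVec, Matrix.vecMulVec_mul, Matrix.vecMul_transpose]

lemma act_act (a b : Fin p → ℝ) (B C : Matrix (Fin p) (Fin p) ℝ) (X : Fin n → Fin p → ℝ) :
    act a B (act b C X) = act (a + B *ᵥ b) (B * C) X := by
  funext i
  simp [act, Matrix.mulVec_add, Matrix.mulVec_mulVec, add_assoc]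

lemma act_zero_one (X : Fin n → Fin p → ℝ) : act 0 1 X = X := by
  funext i; simp [act]

lemma act_standardize {T : Matrix (Fin p) (Fin p) ℝ} (hT : IsUnit T.det)
    (X : Fin n → Fin p → ℝ) : act (sampleMean X) T (standardize T X) = X := by
  funext i
  simp [act, standardize, Matrix.mulVec_mulVec, Matrix.mul_nonsing_inv _ hT]

lemma standardize_eq_act (T : Matrix (Fin p) (Fin p) ℝ)
    (X : Fin n → Fin p → ℝ) : standardize T X = act (-(T⁻¹ *ᵥ sampleMean X)) T⁻¹ X := by
  funext i
  simp [act, standardize, Matrix.mulVec_sub]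
  abel

lemma sampleMean_standardize (hn : n ≠ 0) (T : Matrix (Fin p) (Fin p) ℝ)
    (X : Fin n → Fin p → ℝ) : sampleMean (standardize T X) = 0 := by
  rw [standardize_eq_act, sampleMean_act hn]; simp

lemma sampleCov_standardize (hn : n ≠ 0) {T : Matrix (Fin p) (Fin p) ℝ} (hT : IsUnit T.det)
    {X : Fin n → Fin p → ℝ} (hX : sampleCov X = T * Tᵀ) : sampleCov (standardize T X) = 1 := by
  rw [standardize_eq_act, sampleCov_act hn, hX, ← Matrix.mul_assoc, Matrix.nonsing_inv_mul _ hT,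
    Matrix.one_mul, ← Matrix.transpose_mul, Matrix.nonsing_inv_mul _ hT, Matrix.transpose_one]

lemma sampleCov_posSemidef (X : Fin n → Fin p → ℝ) : (sampleCov X).PosSemidef := by
  refine Matrix.PosSemidef.smul (Matrix.posSemidef_sum _ fun i _ => ?_) (by positivity)
  have := Matrix.posSemidef_vecMulVec_self_star (X i - sampleMean X)
  simpa using this

lemma exists_cholesky_sampleCov {X : Fin n → Fin p → ℝ} (h : (sampleCov X).det ≠ 0) :
    ∃ T ∈ LT p, sampleCov X = T * Tᵀ :=
  exists_cholesky ((sampleCov_posSemidef X).posDef_iff_det_ne_zero.2 h)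

lemma det_mul_transpose_ne_zero {T : Matrix (Fin p) (Fin p) ℝ} (hT : T.det ≠ 0) :
    (T * Tᵀ).det ≠ 0 := by
  rw [Matrix.det_mul, Matrix.det_transpose]; exact mul_ne_zero hT hT

lemma det_sampleCov_act (hn : n ≠ 0) (a : Fin p → ℝ) {B : Matrix (Fin p) (Fin p) ℝ}
    (hB : B.det ≠ 0) (X : Fin n → Fin p → ℝ) :
    (sampleCov (act a B X)).det ≠ 0 ↔ (sampleCov X).det ≠ 0 := by
  rw [sampleCov_act hn, Matrix.det_mul, Matrix.det_mul, Matrix.det_transpose]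
  simp [hB]

/-- Every nonsingular matrix agrees with an element of `LT(p)` up to a right orthogonal factor. -/
lemma exists_lower_mul_transpose_eq {B : Matrix (Fin p) (Fin p) ℝ} (hB : B.det ≠ 0) :
    ∃ T ∈ LT p, B * Bᵀ = T * Tᵀ := by
  have h : (B * Bᵀ).PosSemidef := by
    have := Matrix.posSemidef_self_mul_conjTranspose B
    rwa [Matrix.conjTranspose_eq_transpose_of_trivial] at this
  exact exists_cholesky (h.posDef_iff_det_ne_zero.2 (det_mul_transpose_ne_zero hB))

/-! ### Coordinates on `LT(p)` and determinants of its translations. -/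

/-- The coordinates of `LT(p)`. -/
def lowerSet (p : ℕ) : Set (LowerIdx p → ℝ) := {t | lowerMatrix t ∈ LT p}

lemma lowerMatrix_apply_of_le (t : LowerIdx p → ℝ) {i j : Fin p} (h : j ≤ i) :
    lowerMatrix t i j = t ⟨(i, j), h⟩ := by
  simp [lowerMatrix, h]

lemma lowerMatrix_lower (t : LowerIdx p → ℝ) : (lowerMatrix t).IsLowerTriangular := by
  intro i j hij
  have : ¬ j ≤ i := not_le.2 hij
  simp [lowerMatrix, this]

/-- The entries on and below the diagonal. -/
def lowerEntries (A : Matrix (Fin p) (Fin p) ℝ) : LowerIdx p → ℝ := fun x => A x.1.1 x.1.2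

lemma lowerMatrix_lowerEntries {A : Matrix (Fin p) (Fin p) ℝ} (hA : A.IsLowerTriangular) :
    lowerMatrix (lowerEntries A) = A := by
  ext i j
  by_cases h : j ≤ i
  · simp [lowerMatrix, h, lowerEntries]
  · simp only [lowerMatrix, Matrix.of_apply, h, dite_false]
    exact (hA (show OrderDual.toDual j < OrderDual.toDual i from not_le.1 h)).symm

lemma lowerEntries_lowerMatrix (t : LowerIdx p → ℝ) : lowerEntries (lowerMatrix t) = t := by
  funext x
  simp only [lowerEntries]
  rw [lowerMatrix_apply_of_le t x.2]

lemma lowerMatrix_add (s t : LowerIdx p → ℝ) :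
    lowerMatrix (s + t) = lowerMatrix s + lowerMatrix t := by
  ext i j; by_cases h : j ≤ i <;> simp [lowerMatrix, h]

lemma lowerMatrix_smul (c : ℝ) (t : LowerIdx p → ℝ) :
    lowerMatrix (c • t) = c • lowerMatrix t := by
  ext i j; by_cases h : j ≤ i <;> simp [lowerMatrix, h]

lemma continuous_lowerMatrix : Continuous (lowerMatrix (p := p)) := by
  refine continuous_pi fun i => continuous_pi fun j => ?_
  by_cases h : j ≤ i
  · simp only [lowerMatrix_apply_of_le _ h]; fun_prop
  · simp only [lowerMatrix, Matrix.of_apply, h, dite_false]; fun_prop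

lemma continuous_lowerMatrix_apply (i j : Fin p) :
    Continuous fun t : LowerIdx p → ℝ => lowerMatrix t i j :=
  continuous_lowerMatrix.matrix_elem i j

lemma mem_lowerSet {t : LowerIdx p → ℝ} : t ∈ lowerSet p ↔ ∀ i, 0 < lowerMatrix t i i :=
  ⟨fun h => h.2, fun h => ⟨fun _ _ hij => lowerMatrix_lower t hij, h⟩⟩

lemma isOpen_lowerSet : IsOpen (lowerSet p) := by
  have : lowerSet p = ⋂ i, {t | 0 < lowerMatrix t i i} := by
    ext t; simp [mem_lowerSet]
  rw [this]
  exact isOpen_iInter_of_finite fun i =>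
    isOpen_lt continuous_const (continuous_lowerMatrix_apply i i)

lemma measurableSet_lowerSet : MeasurableSet (lowerSet p) := isOpen_lowerSet.measurableSet

/-- Left multiplication by `U` in the coordinates of lower triangular matrices. -/
def leftMul (U : Matrix (Fin p) (Fin p) ℝ) : (LowerIdx p → ℝ) →ₗ[ℝ] (LowerIdx p → ℝ) where
  toFun t := lowerEntries (U * lowerMatrix t)
  map_add' s t := by rw [lowerMatrix_add, Matrix.mul_add]; rfl
  map_smul' c t := by rw [lowerMatrix_smul, Matrix.mul_smul]; rfl

/-- Right multiplication by `U` in the coordinates of lower triangular matrices. -/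
def rightMul (U : Matrix (Fin p) (Fin p) ℝ) : (LowerIdx p → ℝ) →ₗ[ℝ] (LowerIdx p → ℝ) where
  toFun t := lowerEntries (lowerMatrix t * U)
  map_add' s t := by rw [lowerMatrix_add, Matrix.add_mul]; rfl
  map_smul' c t := by rw [lowerMatrix_smul, Matrix.smul_mul]; rfl

lemma lowerMatrix_leftMul {U : Matrix (Fin p) (Fin p) ℝ} (hU : U.IsLowerTriangular)
    (t : LowerIdx p → ℝ) : lowerMatrix (leftMul U t) = U * lowerMatrix t :=
  lowerMatrix_lowerEntries (Matrix.BlockTriangular.mul hU (lowerMatrix_lower t))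

lemma lowerMatrix_rightMul {U : Matrix (Fin p) (Fin p) ℝ} (hU : U.IsLowerTriangular)
    (t : LowerIdx p → ℝ) : lowerMatrix (rightMul U t) = lowerMatrix t * U :=
  lowerMatrix_lowerEntries (Matrix.BlockTriangular.mul (lowerMatrix_lower t) hU)

lemma leftMul_mem {U : Matrix (Fin p) (Fin p) ℝ} (hU : U ∈ LT p) (t : LowerIdx p → ℝ) :
    leftMul U t ∈ lowerSet p ↔ t ∈ lowerSet p := by
  simp only [mem_lowerSet, lowerMatrix_leftMul (LT.lower hU),
    mul_diag_of_lower (LT.lower hU) (lowerMatrix_lower t)]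
  exact forall_congr' fun i => mul_pos_iff_of_pos_left (hU.2 i)

lemma rightMul_mem {U : Matrix (Fin p) (Fin p) ℝ} (hU : U ∈ LT p) (t : LowerIdx p → ℝ) :
    rightMul U t ∈ lowerSet p ↔ t ∈ lowerSet p := by
  simp only [mem_lowerSet, lowerMatrix_rightMul (LT.lower hU),
    mul_diag_of_lower (lowerMatrix_lower t) (LT.lower hU)]
  exact forall_congr' fun i => mul_pos_iff_of_pos_right (hU.2 i)

/-- Nonvanishing suffices for right translations: their determinant enters only a multiplier that
cancels in the ratio. For left translations the exact value matters. -/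
lemma det_rightMul_ne_zero {U : Matrix (Fin p) (Fin p) ℝ} (hU : U ∈ LT p) :
    LinearMap.det (rightMul U) ≠ 0 := by
  have h : rightMul U ∘ₗ rightMul U⁻¹ = LinearMap.id := by
    refine LinearMap.ext fun t => ?_
    change lowerEntries (lowerMatrix (rightMul U⁻¹ t) * U) = t
    rw [lowerMatrix_rightMul (LT.lower (LT.inv hU)), Matrix.mul_assoc,
      Matrix.nonsing_inv_mul _ (LT.isUnit_det hU), Matrix.mul_one, lowerEntries_lowerMatrix]
  intro h0
  have := congrArg LinearMap.det h
  rw [LinearMap.det_comp, h0, zero_mul, LinearMap.det_id] at this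
  exact zero_ne_one this

lemma card_row (i : Fin p) : Fintype.card {x : LowerIdx p // x.1.1 = i} = (i : ℕ) + 1 := by
  have e : {x : LowerIdx p // x.1.1 = i} ≃ {j : Fin p // j ≤ i} :=
    { toFun := fun x => ⟨x.1.1.2, by have := x.1.2; rw [x.2] at this; exact this⟩
      invFun := fun j => ⟨⟨(i, j.1), j.2⟩, rfl⟩
      left_inv := by rintro ⟨⟨⟨a, b⟩, h⟩, rfl⟩; rfl
      right_inv := fun j => rfl }
  rw [Fintype.card_congr e, Fintype.card_subtype]
  have : (Finset.univ.filter fun j : Fin p => j ≤ i) = Finset.Iic i := by ext; simp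
  rw [this, Fin.card_Iic]

/-- With the coordinates grouped by row, left multiplication is block triangular, because `U` is.
The block of row `i` is `U i i` times the identity, of size `i + 1`, the number of free entries in
that row. -/
lemma det_leftMul {U : Matrix (Fin p) (Fin p) ℝ} (hU : U ∈ LT p) :
    LinearMap.det (leftMul U) = ∏ i, U i i ^ ((i : ℕ) + 1) := by
  classical
  rw [← LinearMap.det_toMatrix']
  have hM : ∀ x y : LowerIdx p, LinearMap.toMatrix' (leftMul U) x y =
      if x.1.2 = y.1.2 then U x.1.1 y.1.1 else 0 := by
    intro x y
    rw [LinearMap.toMatrix'_apply]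
    change (U * lowerMatrix _ : Matrix (Fin p) (Fin p) ℝ) x.1.1 x.1.2 = _
    rw [Matrix.mul_apply, Finset.sum_eq_single y.1.1]
    · by_cases h : x.1.2 = y.1.2
      · have h2 : x.1.2 ≤ y.1.1 := h ▸ y.2
        have h3 : (⟨(y.1.1, x.1.2), h2⟩ : LowerIdx p) = y := by
          ext <;> simp [h]
        rw [lowerMatrix_apply_of_le _ h2, h3]
        simp [h]
      · rw [if_neg h]
        by_cases h2 : x.1.2 ≤ y.1.1
        · rw [lowerMatrix_apply_of_le _ h2, Pi.single_eq_of_ne, mul_zero]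
          intro h3
          have h4 := congrArg (fun z : LowerIdx p => z.1.2) h3
          exact h h4
        · simp [lowerMatrix, h2]
    · intro k _ hk
      by_cases h2 : x.1.2 ≤ k
      · rw [lowerMatrix_apply_of_le _ h2, Pi.single_eq_of_ne, mul_zero]
        intro h3
        have h4 := congrArg (fun z : LowerIdx p => z.1.1) h3
        exact hk h4
      · simp [lowerMatrix, h2]
    · simp
  have hbt : (LinearMap.toMatrix' (leftMul U)).BlockTriangular
      (fun x : LowerIdx p => OrderDual.toDual x.1.1) := by
    intro x y hxy
    rw [hM, LT.lower hU hxy, ite_self]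
  rw [hbt.det_fintype]
  refine Fintype.prod_equiv OrderDual.ofDual _ _ fun i => ?_
  have hsq : (LinearMap.toMatrix' (leftMul U)).toSquareBlock
      (fun x : LowerIdx p => OrderDual.toDual x.1.1) i =
      Matrix.diagonal fun _ => U (OrderDual.ofDual i) (OrderDual.ofDual i) := by
    ext ⟨x, hx⟩ ⟨y, hy⟩
    have hx' : x.1.1 = OrderDual.ofDual i := hx
    have hy' : y.1.1 = OrderDual.ofDual i := hy
    rw [Matrix.toSquareBlock_def, Matrix.of_apply, hM, Matrix.diagonal_apply]
    simp only [Subtype.mk.injEq]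
    rw [hx', hy']
    congr 1
    exact propext ⟨fun h => Subtype.ext (Prod.ext (hx'.trans hy'.symm) h), fun h => by rw [h]⟩
  rw [hsq, Matrix.det_diagonal, Finset.prod_const, Finset.card_univ]
  congr 1
  exact card_row _

/-! ### Change of variables under linear and affine maps. -/

lemma lintegral_comp_linearMap {E : Type*} [NormedAddCommGroup E] [NormedSpace ℝ E]
    [MeasurableSpace E] [BorelSpace E] [FiniteDimensional ℝ E] (μ : Measure E) [μ.IsAddHaarMeasure]
    {L : E →ₗ[ℝ] E} (hL : LinearMap.det L ≠ 0) {F : E → ℝ≥0∞} (hF : Measurable F) :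
    ∫⁻ x, F (L x) ∂μ = ENNReal.ofReal |(LinearMap.det L)⁻¹| * ∫⁻ x, F x ∂μ := by
  rw [← lintegral_map hF L.continuous_of_finiteDimensional.measurable,
    Measure.map_linearMap_addHaar_eq_smul_addHaar μ hL, lintegral_smul_measure, smul_eq_mul]

lemma setLIntegral_comp_linearMap {E : Type*} [NormedAddCommGroup E] [NormedSpace ℝ E]
    [MeasurableSpace E] [BorelSpace E] [FiniteDimensional ℝ E] (μ : Measure E) [μ.IsAddHaarMeasure]
    {L : E →ₗ[ℝ] E} (hL : LinearMap.det L ≠ 0) {F : E → ℝ≥0∞} (hF : Measurable F) {s : Set E}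
    (hs : MeasurableSet s) (h : ∀ x, L x ∈ s ↔ x ∈ s) :
    ∫⁻ x in s, F (L x) ∂μ = ENNReal.ofReal |(LinearMap.det L)⁻¹| * ∫⁻ x in s, F x ∂μ := by
  rw [← lintegral_indicator hs, ← lintegral_indicator hs,
    ← lintegral_comp_linearMap μ hL (hF.indicator hs)]
  refine lintegral_congr fun x => ?_
  by_cases hx : x ∈ s
  · rw [Set.indicator_of_mem hx, Set.indicator_of_mem ((h x).2 hx)]
  · rw [Set.indicator_of_notMem hx, Set.indicator_of_notMem (mt (h x).1 hx)]

lemma lintegral_comp_affine {B : Matrix (Fin p) (Fin p) ℝ} (hB : B.det ≠ 0) (b : Fin p → ℝ)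
    {F : (Fin p → ℝ) → ℝ≥0∞} (hF : Measurable F) :
    ∫⁻ x, F (b + B *ᵥ x) = ENNReal.ofReal |B.det|⁻¹ * ∫⁻ x, F x := by
  have hd : LinearMap.det (Matrix.toLin' B) = B.det := LinearMap.det_toLin' B
  have := lintegral_comp_linearMap volume (L := Matrix.toLin' B) (by rwa [hd])
    (F := fun x => F (b + x)) (hF.comp (measurable_const_add b))
  simp only [Matrix.toLin'_apply, hd, abs_inv] at this
  rw [this, lintegral_add_left_eq_self]

lemma measurable_affine (B : Matrix (Fin p) (Fin p) ℝ) (b : Fin p → ℝ) :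
    Measurable fun x : Fin p → ℝ => b + B *ᵥ x := by
  have : Continuous fun x : Fin p → ℝ => b + B *ᵥ x :=
    continuous_const.add (continuous_const.matrix_mulVec continuous_id)
  exact this.measurable

lemma map_affine_volume {B : Matrix (Fin p) (Fin p) ℝ} (hB : B.det ≠ 0) (b : Fin p → ℝ) :
    (volume : Measure (Fin p → ℝ)).map (fun x => b + B *ᵥ x) =
      ENNReal.ofReal |B.det|⁻¹ • volume := by
  ext s hs
  have h := lintegral_comp_affine hB b (measurable_one.indicator hs)
  rw [lintegral_indicator_one hs] at h
  rw [Measure.map_apply (measurable_affine B b) hs, Measure.smul_apply, smul_eq_mul, ← h,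
    ← lintegral_indicator_one (measurable_affine B b hs)]
  rfl

lemma measurable_act (a : Fin p → ℝ) (B : Matrix (Fin p) (Fin p) ℝ) :
    Measurable (act (n := n) a B) :=
  measurable_pi_lambda _ fun i => (measurable_affine B a).comp (measurable_pi_apply i)

lemma lintegral_comp_act {B : Matrix (Fin p) (Fin p) ℝ} (hB : B.det ≠ 0) (b : Fin p → ℝ)
    {F : (Fin n → Fin p → ℝ) → ℝ≥0∞} (hF : Measurable F) :
    ∫⁻ X, F (act b B X) = ENNReal.ofReal (|B.det|⁻¹ ^ n) * ∫⁻ X, F X := by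
  have : SigmaFinite ((volume : Measure (Fin p → ℝ)).map (fun x => b + B *ᵥ x)) := by
    rw [map_affine_volume hB]
    exact inferInstanceAs (SigmaFinite ((Real.toNNReal |B.det|⁻¹) • (volume : Measure (Fin p → ℝ))))
  have hmap : (volume : Measure (Fin n → Fin p → ℝ)).map (act b B) =
      ENNReal.ofReal (|B.det|⁻¹ ^ n) • volume := by
    have h1 : (volume : Measure (Fin n → Fin p → ℝ)).map (act b B) =
        Measure.pi fun _ => (volume : Measure (Fin p → ℝ)).map (fun x => b + B *ᵥ x) :=
      Measure.pi_map_pi fun _ => (measurable_affine B b).aemeasurable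
    rw [h1]
    refine Measure.pi_eq fun s hs => ?_
    simp only [Measure.smul_apply, smul_eq_mul, map_affine_volume hB, volume_pi_pi,
      Finset.prod_mul_distrib, Finset.prod_const, Finset.card_univ, Fintype.card_fin]
    rw [ENNReal.ofReal_pow (by positivity)]
  rw [← lintegral_map hF (measurable_act b B), hmap, lintegral_smul_measure, smul_eq_mul]

/-! ### The sample covariance matrix is almost surely nonsingular -/

lemma sampleCov_apply (X : Fin n → Fin p → ℝ) (i j : Fin p) :
    sampleCov X i j =
      (n : ℝ)⁻¹ * ∑ k, (X k - sampleMean X) i * (X k - sampleMean X) j := by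
  simp [sampleCov, Matrix.sum_apply, Matrix.vecMulVec_apply]

lemma sampleMean_add (X Y : Fin n → Fin p → ℝ) :
    sampleMean (X + Y) = sampleMean X + sampleMean Y := by
  simp [sampleMean, Finset.sum_add_distrib]

lemma sampleMean_smul (r : ℝ) (X : Fin n → Fin p → ℝ) :
    sampleMean (r • X) = r • sampleMean X := by
  change (n : ℝ)⁻¹ • ∑ i, r • X i = r • (n : ℝ)⁻¹ • ∑ i, X i
  rw [Finset.smul_sum, Finset.smul_sum, Finset.smul_sum]
  exact Finset.sum_congr rfl fun i _ => smul_comm _ _ _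

lemma sampleCov_smul (r : ℝ) (X : Fin n → Fin p → ℝ) :
    sampleCov (r • X) = r ^ 2 • sampleCov X := by
  ext i j
  rw [Matrix.smul_apply, smul_eq_mul, sampleCov_apply, sampleCov_apply, sampleMean_smul,
    mul_left_comm (r ^ 2)]
  congr 1
  rw [Finset.mul_sum]
  refine Finset.sum_congr rfl fun k _ => ?_
  simp only [Pi.sub_apply, Pi.smul_apply, smul_eq_mul]
  ring

/-- The witness has the standard basis vectors as its first `p` rows and zeros below. A vector in
the kernel of the covariance matrix has the same inner product with every row. The zero row `p`,
available because `p < n`, makes this product zero, so every coordinate of the vector vanishes. -/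
lemma exists_det_sampleCov_ne_zero (hn : p < n) :
    ∃ X : Fin n → Fin p → ℝ, (sampleCov X).det ≠ 0 := by
  refine ⟨fun i j => if (i : ℕ) = j then 1 else 0, fun h => ?_⟩
  set X : Fin n → Fin p → ℝ := fun i j => if (i : ℕ) = j then 1 else 0 with hX
  obtain ⟨v, hv, hv0⟩ := Matrix.exists_mulVec_eq_zero_iff.2 h
  have hq : v ⬝ᵥ sampleCov X *ᵥ v = (n : ℝ)⁻¹ * ∑ k, ((X k - sampleMean X) ⬝ᵥ v) ^ 2 := by
    simp only [sampleCov, Matrix.smul_mulVec, dotProduct_smul, smul_eq_mul, Matrix.sum_mulVec,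
      dotProduct_sum, Matrix.vecMulVec_mulVec]
    congr 1
    refine Finset.sum_congr rfl fun k _ => ?_
    simp [dotProduct_comm v, sq]
  have hn0 : (0 : ℝ) < (n : ℝ)⁻¹ := by
    have : 0 < n := by omega
    positivity
  rw [hv0, dotProduct_zero] at hq
  have hs : ∑ k, ((X k - sampleMean X) ⬝ᵥ v) ^ 2 = 0 :=
    (mul_eq_zero.1 hq.symm).resolve_left hn0.ne'
  have hk : ∀ k, X k ⬝ᵥ v = sampleMean X ⬝ᵥ v := by
    intro k
    have := (Finset.sum_eq_zero_iff_of_nonneg fun k _ => sq_nonneg _).1 hs k (Finset.mem_univ k)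
    rw [sq_eq_zero_iff, sub_dotProduct] at this
    linarith
  have hlast : X ⟨p, hn⟩ = 0 := by
    funext j
    have : p ≠ (j : ℕ) := by omega
    simp [hX, this]
  have hm : sampleMean X ⬝ᵥ v = 0 := by rw [← hk ⟨p, hn⟩, hlast, zero_dotProduct]
  apply hv
  funext j
  have hj := hk ⟨j, j.2.trans hn⟩
  rw [hm] at hj
  have : X ⟨j, j.2.trans hn⟩ = Pi.single j 1 := by
    funext l
    simp only [hX, Pi.single_apply]
    congr 1
    exact propext ⟨fun h => (Fin.ext h).symm, fun h => by rw [h]⟩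
  rwa [this, single_one_dotProduct] at hj

/-- Along a line the determinant is a polynomial in the parameter, nonzero at `r = 0`, so it has
finitely many roots. -/
lemma finite_det_sampleCov_add_smul_eq_zero {X : Fin n → Fin p → ℝ} (hX : (sampleCov X).det ≠ 0)
    (Y : Fin n → Fin p → ℝ) : {r : ℝ | (sampleCov (X + r • Y)).det = 0}.Finite := by
  let M : Matrix (Fin p) (Fin p) (Polynomial ℝ) := Matrix.of fun i j =>
    Polynomial.C (n : ℝ)⁻¹ * ∑ k,
      (Polynomial.C ((X k - sampleMean X) i) + Polynomial.X * Polynomial.C ((Y k - sampleMean Y) i)) *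
      (Polynomial.C ((X k - sampleMean X) j) + Polynomial.X * Polynomial.C ((Y k - sampleMean Y) j))
  have hM : ∀ r : ℝ, M.det.eval r = (sampleCov (X + r • Y)).det := by
    intro r
    rw [← Polynomial.coe_evalRingHom, RingHom.map_det]
    congr 1
    ext i j
    rw [RingHom.mapMatrix_apply, Matrix.map_apply, sampleCov_apply, Polynomial.coe_evalRingHom]
    simp only [M, Matrix.of_apply, Polynomial.eval_mul, Polynomial.eval_C,
      Polynomial.eval_finsetSum, Polynomial.eval_add, Polynomial.eval_X, sampleMean_add,
      sampleMean_smul, Pi.sub_apply, Pi.add_apply, Pi.smul_apply, smul_eq_mul]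
    congr 1
    refine Finset.sum_congr rfl fun k _ => ?_
    ring
  have hne : M.det ≠ 0 := by
    intro h
    have := hM 0
    rw [h, Polynomial.eval_zero, zero_smul, add_zero] at this
    exact hX this.symm
  refine (Polynomial.finite_setOfPred_isRoot hne).subset fun r hr => ?_
  exact (hM r).trans hr

lemma continuous_sampleMean : Continuous (sampleMean (n := n) (p := p)) := by
  unfold sampleMean
  fun_prop

lemma continuous_sampleCov : Continuous (sampleCov (n := n) (p := p)) := by
  have h := continuous_sampleMean (n := n) (p := p)
  refine continuous_matrix fun i j => ?_
  simp only [sampleCov_apply]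
  have h' : ∀ i, Continuous fun X : Fin n → Fin p → ℝ => sampleMean X i :=
    fun i => (continuous_apply i).comp h
  simp only [Pi.sub_apply]
  fun_prop

lemma measurableSet_det_sampleCov_ne_zero :
    MeasurableSet {X : Fin n → Fin p → ℝ | (sampleCov X).det ≠ 0} :=
  (isOpen_ne_fun continuous_sampleCov.matrix_det continuous_const).measurableSet

lemma ae_det_sampleCov_ne_zero (hn : p < n) :
    ∀ᵐ X : Fin n → Fin p → ℝ, (sampleCov X).det ≠ 0 := by
  obtain ⟨X₀, hX₀⟩ := exists_det_sampleCov_ne_zero hn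
  -- It suffices to treat almost every point of each line `Y + s X₀`. For `s ≠ 0`, rescaling turns
  -- the point into `X₀ + s⁻¹ Y`, and singularity of the covariance is unaffected by scaling.
  refine ae_mem_of_ae_add_linearMap_mem (LinearMap.toSpanSingleton ℝ (Fin n → Fin p → ℝ) X₀)
    (volume : Measure ℝ) volume measurableSet_det_sampleCov_ne_zero fun Y => ?_
  have hfin := finite_det_sampleCov_add_smul_eq_zero hX₀ Y
  have hfin2 : ({0} ∪ (fun r : ℝ => r⁻¹) '' {r : ℝ | (sampleCov (X₀ + r • Y)).det = 0}).Finite :=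
    (Set.finite_singleton 0).union (hfin.image _)
  filter_upwards [compl_mem_ae_iff.2 (hfin2.measure_zero volume)] with s hs
  simp only [Set.mem_compl_iff, Set.mem_union, Set.mem_singleton_iff, Set.mem_image, not_or] at hs
  obtain ⟨hs0, hs⟩ := hs
  intro h
  refine hs ⟨s⁻¹, ?_, inv_inv s⟩
  have hY : X₀ + s⁻¹ • Y = s⁻¹ • (Y + LinearMap.toSpanSingleton ℝ (Fin n → Fin p → ℝ) X₀ s) := by
    rw [LinearMap.toSpanSingleton_apply, smul_add, smul_smul, inv_mul_cancel₀ hs0, one_smul,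
      add_comm]
  change (sampleCov (X₀ + s⁻¹ • Y)).det = 0
  rw [hY, sampleCov_smul, Matrix.det_smul, h, mul_zero]

/-! ### Measurability of matrix operations -/

lemma measurable_det {α : Type*} [MeasurableSpace α] {A : α → Matrix (Fin p) (Fin p) ℝ}
    (hA : ∀ i j, Measurable fun x => A x i j) : Measurable fun x => (A x).det := by
  simp only [Matrix.det_apply]
  refine Finset.measurable_sum _ fun σ _ => ?_
  exact (Finset.measurable_prod _ fun i _ => hA _ _).const_smul _

lemma measurable_inv_apply {α : Type*} [MeasurableSpace α] {A : α → Matrix (Fin p) (Fin p) ℝ}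
    (hA : ∀ i j, Measurable fun x => A x i j) (i j : Fin p) :
    Measurable fun x => (A x)⁻¹ i j := by
  simp only [Matrix.inv_def, Matrix.smul_apply, smul_eq_mul, Ring.inverse_eq_inv',
    Matrix.adjugate_apply]
  refine (measurable_det hA).fun_inv.fun_mul (measurable_det fun k l => ?_)
  by_cases h : k = j
  · subst h; simp
  · simpa [Matrix.updateRow_ne h] using hA k l

lemma measurable_mulVec {α : Type*} [MeasurableSpace α] {A : α → Matrix (Fin p) (Fin p) ℝ}
    {v : α → Fin p → ℝ} (hA : ∀ i j, Measurable fun x => A x i j) (hv : Measurable v) :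
    Measurable fun x => A x *ᵥ v x := by
  refine measurable_pi_lambda _ fun i => ?_
  simp only [Matrix.mulVec, dotProduct]
  exact Finset.measurable_sum _ fun j _ => (hA i j).fun_mul ((measurable_pi_apply j).comp hv)

lemma measurable_dotProduct {α : Type*} [MeasurableSpace α] {v w : α → Fin p → ℝ}
    (hv : Measurable v) (hw : Measurable w) : Measurable fun x => v x ⬝ᵥ w x := by
  simp only [dotProduct]
  exact Finset.measurable_sum _ fun j _ =>
    ((measurable_pi_apply j).comp hv).fun_mul ((measurable_pi_apply j).comp hw)

lemma measurable_act_comp {α : Type*} [MeasurableSpace α] {A : α → Matrix (Fin p) (Fin p) ℝ}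
    {a : α → Fin p → ℝ} {X : α → Fin n → Fin p → ℝ} (ha : Measurable a)
    (hA : ∀ i j, Measurable fun x => A x i j) (hX : Measurable X) :
    Measurable fun x => act (a x) (A x) (X x) :=
  measurable_pi_lambda _ fun i =>
    ha.add (measurable_mulVec hA ((measurable_pi_apply i).comp hX))

lemma measurable_lowerMatrix_apply (i j : Fin p) :
    Measurable fun t : LowerIdx p → ℝ => lowerMatrix t i j :=
  (continuous_lowerMatrix_apply i j).measurable

/-! ### Integration over the group -/

/-- Lebesgue measure on `LT(p) × ℝ^p`. -/
def groupMeasure (p : ℕ) : Measure ((LowerIdx p → ℝ) × (Fin p → ℝ)) :=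
  (volume.restrict (lowerSet p)).prod volume

instance : SFinite (groupMeasure p) := by unfold groupMeasure; infer_instance

lemma ae_groupMeasure_mem : ∀ᵐ q ∂(groupMeasure p), q.1 ∈ lowerSet p :=
  Measure.quasiMeasurePreserving_fst.ae (ae_restrict_mem measurableSet_lowerSet)

/-- The Jacobian of left translation on `ℝ^p ⋊ LT(p)`. -/
def leftJac (T : Matrix (Fin p) (Fin p) ℝ) : ℝ := ∏ i, T i i ^ ((i : ℕ) + 2)

lemma leftJac_pos {T : Matrix (Fin p) (Fin p) ℝ} (hT : T ∈ LT p) : 0 < leftJac T :=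
  Finset.prod_pos fun i _ => pow_pos (hT.2 i) _

lemma leftJac_mul {T U : Matrix (Fin p) (Fin p) ℝ} (hT : T ∈ LT p) (hU : U ∈ LT p) :
    leftJac (T * U) = leftJac T * leftJac U := by
  simp only [leftJac, mul_diag_of_lower (LT.lower hT) (LT.lower hU), mul_pow,
    Finset.prod_mul_distrib]

/-- The exponent `i + 2` in `leftJac` is `i + 1` from the matrix coordinates in row `i`, plus `1`
from `a ↦ b + U a` on the translation part. -/
lemma leftJac_eq {U : Matrix (Fin p) (Fin p) ℝ} (hU : U ∈ LT p) :
    leftJac U = LinearMap.det (leftMul U) * U.det := by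
  rw [det_leftMul hU, LT.det_eq hU, ← Finset.prod_mul_distrib]
  exact Finset.prod_congr rfl fun i _ => by rw [← pow_succ]

lemma measurable_leftJac : Measurable fun t : LowerIdx p → ℝ => leftJac (lowerMatrix t) :=
  Finset.measurable_prod _ fun i _ => (measurable_lowerMatrix_apply i i).pow_const _

/-- The weight `∏ᵢ t_{ii}^{n-i-1}` of the orbit integral. -/
def orbitWeight (n : ℕ) (T : Matrix (Fin p) (Fin p) ℝ) : ℝ :=
  ∏ i : Fin p, T i i ^ ((n : ℤ) - ((i : ℕ) + 1 : ℤ) - 1)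

/-- This explains the exponents `n - i - 1` of the orbit integral: the Jacobian of the action on `n`
observations times the left Haar density `1 / leftJac`. -/
lemma orbitWeight_eq {T : Matrix (Fin p) (Fin p) ℝ} (hT : T ∈ LT p) :
    orbitWeight n T = T.det ^ n * (leftJac T)⁻¹ := by
  rw [LT.det_eq hT, leftJac, ← Finset.prod_pow, ← Finset.prod_inv_distrib,
    ← Finset.prod_mul_distrib]
  refine Finset.prod_congr rfl fun i _ => ?_
  rw [← zpow_natCast, ← zpow_natCast, ← zpow_neg, ← zpow_add₀ (hT.2 i).ne']
  congr 1
  push_cast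
  ring

lemma orbitWeight_pos {T : Matrix (Fin p) (Fin p) ℝ} (hT : T ∈ LT p) : 0 < orbitWeight n T :=
  Finset.prod_pos fun i _ => zpow_pos (hT.2 i) _

lemma orbitWeight_mul {T U : Matrix (Fin p) (Fin p) ℝ} (hT : T ∈ LT p) (hU : U ∈ LT p) :
    orbitWeight n (T * U) = orbitWeight n T * orbitWeight n U := by
  simp only [orbitWeight, mul_diag_of_lower (LT.lower hT) (LT.lower hU), mul_zpow,
    Finset.prod_mul_distrib]

lemma measurable_orbitWeight :
    Measurable fun t : LowerIdx p → ℝ => orbitWeight n (lowerMatrix t) :=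
  Finset.measurable_prod _ fun i _ => (measurable_lowerMatrix_apply i i).pow_const _

/-- The joint density of the sample. -/
def jointDensity (g : (Fin p → ℝ) → ℝ) (X : Fin n → Fin p → ℝ) : ℝ≥0∞ :=
  ENNReal.ofReal (∏ i, g (X i))

lemma measurable_jointDensity {g : (Fin p → ℝ) → ℝ} (hg : Measurable g) :
    Measurable (jointDensity (n := n) g) :=
  (Finset.measurable_prod _ fun i _ => hg.comp (measurable_pi_apply i)).ennreal_ofReal

lemma measurable_jointDensity_act {g : (Fin p → ℝ) → ℝ} (hg : Measurable g) :
    Measurable fun q : (Fin n → Fin p → ℝ) × ((LowerIdx p → ℝ) × (Fin p → ℝ)) =>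
      jointDensity g (act q.2.2 (lowerMatrix q.2.1) q.1) :=
  (measurable_jointDensity hg).comp (measurable_act_comp (by fun_prop)
    (fun i j => (measurable_lowerMatrix_apply i j).comp (by fun_prop)) measurable_fst)

lemma orbitIntegral_eq {g : (Fin p → ℝ) → ℝ} (hg : Measurable g) (X : Fin n → Fin p → ℝ) :
    orbitIntegral g X = ∫⁻ q, jointDensity g (act q.2 (lowerMatrix q.1) X) *
      ENNReal.ofReal (orbitWeight n (lowerMatrix q.1)) ∂(groupMeasure p) := by
  have hm : Measurable fun q : (LowerIdx p → ℝ) × (Fin p → ℝ) =>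
      jointDensity g (act q.2 (lowerMatrix q.1) X) :=
    ((measurable_jointDensity_act hg).comp (measurable_prodMk_left (x := X)) :)
  have hm2 : Measurable fun q : (LowerIdx p → ℝ) × (Fin p → ℝ) =>
      jointDensity g (act q.2 (lowerMatrix q.1) X) *
        ENNReal.ofReal (orbitWeight n (lowerMatrix q.1)) :=
    (hm.fun_mul (measurable_orbitWeight.comp measurable_fst).ennreal_ofReal :)
  rw [groupMeasure, lintegral_prod _ hm2.aemeasurable]
  refine lintegral_congr fun t => ?_
  have hmt : Measurable fun a : Fin p → ℝ => jointDensity g (act a (lowerMatrix t) X) :=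
    (hm.comp (measurable_prodMk_left (x := t)) :)
  exact (lintegral_mul_const _ hmt).symm

lemma measurable_orbitIntegral {g : (Fin p → ℝ) → ℝ} (hg : Measurable g) :
    Measurable (orbitIntegral (n := n) g) := by
  have : orbitIntegral (n := n) g = fun X => ∫⁻ q, jointDensity g (act q.2 (lowerMatrix q.1) X) *
      ENNReal.ofReal (orbitWeight n (lowerMatrix q.1)) ∂(groupMeasure p) :=
    funext fun X => orbitIntegral_eq hg X
  rw [this]
  exact Measurable.lintegral_prod_right' ((measurable_jointDensity_act hg).mul
    (measurable_orbitWeight.comp (measurable_fst.comp measurable_snd)).ennreal_ofReal)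

/-- Relative invariance of the orbit integral. -/
lemma exists_orbitIntegral_act {U : Matrix (Fin p) (Fin p) ℝ} (hU : U ∈ LT p) :
    ∃ m : ℝ≥0∞, m ≠ 0 ∧ m ≠ ∞ ∧ ∀ (b : Fin p → ℝ) (g : (Fin p → ℝ) → ℝ), Measurable g →
      ∀ X : Fin n → Fin p → ℝ, orbitIntegral g (act b U X) = m * orbitIntegral g X := by
  have hd := det_rightMul_ne_zero hU
  have hw := orbitWeight_pos (n := n) hU
  -- The multiplier comes from the substitution `T ↦ T U` alone, so it depends neither on `b` nor on
  -- the density. This is why it cancels in the ratio.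
  refine ⟨ENNReal.ofReal (orbitWeight n U)⁻¹ * ENNReal.ofReal |(LinearMap.det (rightMul U))⁻¹|,
    ?_, ENNReal.mul_ne_top ENNReal.ofReal_ne_top ENNReal.ofReal_ne_top, fun b g hg X => ?_⟩
  · refine mul_ne_zero ?_ ?_
    · exact (ENNReal.ofReal_pos.2 (inv_pos.2 hw)).ne'
    · exact (ENNReal.ofReal_pos.2 (abs_pos.2 (inv_ne_zero hd))).ne'
  have hgX : Measurable fun q : (LowerIdx p → ℝ) × (Fin p → ℝ) =>
      jointDensity g (act q.2 (lowerMatrix q.1) X) :=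
    ((measurable_jointDensity_act hg).comp (measurable_prodMk_left (x := X)) :)
  set K : (LowerIdx p → ℝ) → ℝ≥0∞ := fun t =>
    ∫⁻ a : Fin p → ℝ, jointDensity g (act a (lowerMatrix t) X) with hK
  have hKm : Measurable K := Measurable.lintegral_prod_right'
    (f := fun q : (LowerIdx p → ℝ) × (Fin p → ℝ) => jointDensity g (act q.2 (lowerMatrix q.1) X))
    hgX
  have h1 : orbitIntegral g X = ∫⁻ t in lowerSet p, K t *
      ENNReal.ofReal (orbitWeight n (lowerMatrix t)) := rfl
  have h2 : orbitIntegral g (act b U X) = ∫⁻ t in lowerSet p,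
      ENNReal.ofReal (orbitWeight n U)⁻¹ * (K (rightMul U t) *
      ENNReal.ofReal (orbitWeight n (lowerMatrix (rightMul U t)))) := by
    change ∫⁻ t in lowerSet p, (∫⁻ a : Fin p → ℝ,
      jointDensity g (act a (lowerMatrix t) (act b U X))) *
        ENNReal.ofReal (orbitWeight n (lowerMatrix t)) = _
    refine setLIntegral_congr_fun measurableSet_lowerSet fun t ht => ?_
    -- Acting by `b` first shifts `a` by `T b`, which translation invariance of Lebesgue measure
    -- absorbs.
    have hin : (∫⁻ a : Fin p → ℝ, jointDensity g (act a (lowerMatrix t) (act b U X))) =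
        K (rightMul U t) := by
      simp only [hK, act_act, lowerMatrix_rightMul (LT.lower hU)]
      exact lintegral_add_right_eq_self
        (fun a => jointDensity g (act a (lowerMatrix t * U) X)) (lowerMatrix t *ᵥ b)
    simp only [hin, lowerMatrix_rightMul (LT.lower hU), orbitWeight_mul ht hU]
    rw [mul_left_comm, ← ENNReal.ofReal_mul (inv_nonneg.2 hw.le)]
    congr 2
    field_simp
  rw [h2, lintegral_const_mul, setLIntegral_comp_linearMap volume hd
    (F := fun t => K t * ENNReal.ofReal (orbitWeight n (lowerMatrix t)))
    (hKm.fun_mul measurable_orbitWeight.ennreal_ofReal) measurableSet_lowerSet (rightMul_mem hU), ← h1,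
    mul_assoc]
  exact (hKm.fun_mul measurable_orbitWeight.ennreal_ofReal).comp
    (rightMul U).continuous_of_finiteDimensional.measurable

/-- Left invariance of the Haar measure of `ℝ^p ⋊ LT(p)`. -/
lemma lintegral_left_translate {U : Matrix (Fin p) (Fin p) ℝ} (hU : U ∈ LT p) (b : Fin p → ℝ)
    {F : (LowerIdx p → ℝ) × (Fin p → ℝ) → ℝ≥0∞} (hF : Measurable F) :
    ∫⁻ q, F (leftMul U q.1, b + U *ᵥ q.2) * ENNReal.ofReal (leftJac (lowerMatrix q.1))⁻¹
        ∂(groupMeasure p) =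
      ∫⁻ q, F q * ENNReal.ofReal (leftJac (lowerMatrix q.1))⁻¹ ∂(groupMeasure p) := by
  have hJ : Measurable fun t : LowerIdx p → ℝ => ENNReal.ofReal (leftJac (lowerMatrix t))⁻¹ :=
    measurable_leftJac.fun_inv.ennreal_ofReal
  have hL : Measurable (leftMul U) := (leftMul U).continuous_of_finiteDimensional.measurable
  set H : (LowerIdx p → ℝ) → ℝ≥0∞ := fun t => ∫⁻ a : Fin p → ℝ, F (t, a) with hH
  have hHm : Measurable H := hF.lintegral_prod_right'
  have hdet : 0 < U.det := LT.det_pos hU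
  have hjac : 0 < leftJac U := leftJac_pos hU
  have hdl : 0 < LinearMap.det (leftMul U) := by
    rw [leftJac_eq hU] at hjac
    exact (pos_iff_pos_of_mul_pos hjac).2 hdet
  have hFt : Measurable fun q : (LowerIdx p → ℝ) × (Fin p → ℝ) =>
      F (leftMul U q.1, b + U *ᵥ q.2) :=
    (hF.comp ((hL.comp measurable_fst).prodMk ((measurable_affine U b).comp measurable_snd)) :)
  have hm1 : Measurable fun q : (LowerIdx p → ℝ) × (Fin p → ℝ) =>
      F (leftMul U q.1, b + U *ᵥ q.2) * ENNReal.ofReal (leftJac (lowerMatrix q.1))⁻¹ :=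
    (hFt.fun_mul (hJ.comp measurable_fst) :)
  have hm2 : Measurable fun q : (LowerIdx p → ℝ) × (Fin p → ℝ) =>
      F q * ENNReal.ofReal (leftJac (lowerMatrix q.1))⁻¹ :=
    (hF.fun_mul (hJ.comp measurable_fst) :)
  rw [groupMeasure, lintegral_prod _ hm1.aemeasurable, lintegral_prod _ hm2.aemeasurable]
  have hFs : ∀ t, Measurable fun a : Fin p → ℝ => F (t, a) := fun t =>
    (hF.comp (measurable_prodMk_left (x := t)) :)
  have h1 : ∀ t, ∫⁻ a : Fin p → ℝ, F (t, a) * ENNReal.ofReal (leftJac (lowerMatrix t))⁻¹ =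
      H t * ENNReal.ofReal (leftJac (lowerMatrix t))⁻¹ := fun t =>
    lintegral_mul_const _ (hFs t)
  have h2 : ∀ t ∈ lowerSet p, ∫⁻ a : Fin p → ℝ, F (leftMul U t, b + U *ᵥ a) *
      ENNReal.ofReal (leftJac (lowerMatrix t))⁻¹ =
      ENNReal.ofReal (|U.det|⁻¹ * leftJac U) * (H (leftMul U t) *
        ENNReal.ofReal (leftJac (lowerMatrix (leftMul U t)))⁻¹) := by
    intro t ht
    have hmt : Measurable fun a : Fin p → ℝ => F (leftMul U t, b + U *ᵥ a) :=
      (hFt.fun_comp (measurable_prodMk_left (x := t)) :)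
    rw [lintegral_mul_const _ hmt,
      lintegral_comp_affine hdet.ne' b (F := fun a => F (leftMul U t, a))
        (hFs _), lowerMatrix_leftMul (LT.lower hU), leftJac_mul hU ht]
    change _ * H (leftMul U t) * _ = _
    have h3 : ENNReal.ofReal (leftJac (lowerMatrix t))⁻¹ = ENNReal.ofReal (leftJac U) *
        ENNReal.ofReal (leftJac U * leftJac (lowerMatrix t))⁻¹ := by
      rw [← ENNReal.ofReal_mul hjac.le]
      congr 1
      have := (leftJac_pos ht).ne'
      field_simp
    rw [ENNReal.ofReal_mul (by positivity), h3]
    ring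
  simp only [h1]
  rw [setLIntegral_congr_fun measurableSet_lowerSet h2, lintegral_const_mul,
    setLIntegral_comp_linearMap volume hdl.ne'
      (F := fun t => H t * ENNReal.ofReal (leftJac (lowerMatrix t))⁻¹) (hHm.fun_mul hJ)
      measurableSet_lowerSet (leftMul_mem hU), ← mul_assoc, ← ENNReal.ofReal_mul (by positivity)]
  -- The Jacobians of the two components multiply to `leftJac U`, which is exactly the factor gained
  -- by the density `1 / leftJac`.
  · have : |U.det|⁻¹ * leftJac U * |(LinearMap.det (leftMul U))⁻¹| = 1 := by
      rw [leftJac_eq hU, abs_of_pos hdet, abs_of_pos (inv_pos.2 hdl)]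
      field_simp
    rw [this, ENNReal.ofReal_one, one_mul]
  · exact (hHm.fun_mul hJ).comp hL

/-- The average of `w` over the inverse group elements, with respect to left Haar measure. -/
def orbitAverage (w : (Fin n → Fin p → ℝ) → ℝ≥0∞) (Y : Fin n → Fin p → ℝ) : ℝ≥0∞ :=
  ∫⁻ q, w (act (-((lowerMatrix q.1)⁻¹ *ᵥ q.2)) (lowerMatrix q.1)⁻¹ Y) *
    ENNReal.ofReal (leftJac (lowerMatrix q.1))⁻¹ ∂(groupMeasure p)

lemma measurable_inv_act : Measurable fun q : (Fin n → Fin p → ℝ) × ((LowerIdx p → ℝ) × (Fin p → ℝ)) =>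
    act (-((lowerMatrix q.2.1)⁻¹ *ᵥ q.2.2)) (lowerMatrix q.2.1)⁻¹ q.1 := by
  have h : ∀ i j, Measurable fun q : (Fin n → Fin p → ℝ) × ((LowerIdx p → ℝ) × (Fin p → ℝ)) =>
      (lowerMatrix q.2.1)⁻¹ i j := fun i j =>
    measurable_inv_apply (fun i j => (measurable_lowerMatrix_apply i j).comp (by fun_prop)) i j
  exact measurable_act_comp (measurable_mulVec h (by fun_prop)).fun_neg h measurable_fst

lemma measurable_comp_inv_act {w : (Fin n → Fin p → ℝ) → ℝ≥0∞} (hw : Measurable w) :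
    Measurable fun q : (Fin n → Fin p → ℝ) × ((LowerIdx p → ℝ) × (Fin p → ℝ)) =>
      w (act (-((lowerMatrix q.2.1)⁻¹ *ᵥ q.2.2)) (lowerMatrix q.2.1)⁻¹ q.1) :=
  hw.comp measurable_inv_act

/-- The integrand is `w (h⁻¹ Y)` for `h = (a, T)`. Replacing `h` by `(b, U) h` cancels the action of
`(b, U)` on the argument, and left Haar measure does not change. -/
lemma orbitAverage_act {w : (Fin n → Fin p → ℝ) → ℝ≥0∞} (hw : Measurable w)
    {U : Matrix (Fin p) (Fin p) ℝ} (hU : U ∈ LT p) (b : Fin p → ℝ) (Z : Fin n → Fin p → ℝ) :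
    orbitAverage w (act b U Z) = orbitAverage w Z := by
  have hm : Measurable fun q : (LowerIdx p → ℝ) × (Fin p → ℝ) =>
      w (act (-((lowerMatrix q.1)⁻¹ *ᵥ q.2)) (lowerMatrix q.1)⁻¹ (act b U Z)) :=
    ((measurable_comp_inv_act hw).comp (measurable_prodMk_left (x := act b U Z)) :)
  rw [orbitAverage, ← lintegral_left_translate hU b hm, orbitAverage]
  refine lintegral_congr fun q => ?_
  congr 2
  rw [act_act, lowerMatrix_leftMul (LT.lower hU), Matrix.mul_inv_rev, Matrix.mul_assoc,
    Matrix.nonsing_inv_mul _ (LT.isUnit_det hU), Matrix.mul_one]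
  congr 1
  rw [Matrix.mulVec_add, Matrix.mulVec_mulVec, Matrix.mul_assoc,
    Matrix.nonsing_inv_mul _ (LT.isUnit_det hU), Matrix.mul_one]
  abel

/-- Unfolding an integral over samples along the orbits of the group. -/
lemma lintegral_mul_orbitIntegral {g : (Fin p → ℝ) → ℝ} (hg : Measurable g)
    {φ w : (Fin n → Fin p → ℝ) → ℝ≥0∞} (hφ : Measurable φ) (hw : Measurable w)
    (hinv : ∀ (a : Fin p → ℝ), ∀ T ∈ LT p, ∀ X, φ (act a T X) = φ X) :
    ∫⁻ X, φ X * w X * orbitIntegral g X = ∫⁻ Y, φ Y * jointDensity g Y * orbitAverage w Y := by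
  have hW : Measurable fun q : (Fin n → Fin p → ℝ) × ((LowerIdx p → ℝ) × (Fin p → ℝ)) =>
      ENNReal.ofReal (orbitWeight n (lowerMatrix q.2.1)) :=
    ((measurable_orbitWeight.comp (measurable_fst.comp measurable_snd)).ennreal_ofReal :)
  have hJ : Measurable fun q : (Fin n → Fin p → ℝ) × ((LowerIdx p → ℝ) × (Fin p → ℝ)) =>
      ENNReal.ofReal (leftJac (lowerMatrix q.2.1))⁻¹ :=
    ((measurable_leftJac.comp (measurable_fst.comp measurable_snd)).fun_inv.ennreal_ofReal :)
  have hD := measurable_jointDensity_act (n := n) hg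
  have hI := measurable_comp_inv_act hw
  have hG := measurable_jointDensity (n := n) hg
  have hDW : Measurable fun q : (Fin n → Fin p → ℝ) × ((LowerIdx p → ℝ) × (Fin p → ℝ)) =>
      jointDensity g (act q.2.2 (lowerMatrix q.2.1) q.1) *
        ENNReal.ofReal (orbitWeight n (lowerMatrix q.2.1)) := (hD.fun_mul hW :)
  have hIJ : Measurable fun q : (Fin n → Fin p → ℝ) × ((LowerIdx p → ℝ) × (Fin p → ℝ)) =>
      w (act (-((lowerMatrix q.2.1)⁻¹ *ᵥ q.2.2)) (lowerMatrix q.2.1)⁻¹ q.1) *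
        ENNReal.ofReal (leftJac (lowerMatrix q.2.1))⁻¹ := (hI.fun_mul hJ :)
  have h1 : ∀ X, φ X * w X * orbitIntegral g X = ∫⁻ q, φ X * w X *
      (jointDensity g (act q.2 (lowerMatrix q.1) X) *
        ENNReal.ofReal (orbitWeight n (lowerMatrix q.1))) ∂(groupMeasure p) := by
    intro X
    rw [orbitIntegral_eq hg, lintegral_const_mul]
    exact (hDW.comp (measurable_prodMk_left (x := X)) :)
  have h2 : ∀ Y, φ Y * jointDensity g Y * orbitAverage w Y = ∫⁻ q, φ Y * jointDensity g Y *
      (w (act (-((lowerMatrix q.1)⁻¹ *ᵥ q.2)) (lowerMatrix q.1)⁻¹ Y) *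
        ENNReal.ofReal (leftJac (lowerMatrix q.1))⁻¹) ∂(groupMeasure p) := by
    intro Y
    rw [orbitAverage, lintegral_const_mul]
    exact (hIJ.comp (measurable_prodMk_left (x := Y)) :)
  have h3 : AEMeasurable (Function.uncurry fun X q => φ X * w X *
      (jointDensity g (act q.2 (lowerMatrix q.1) X) *
        ENNReal.ofReal (orbitWeight n (lowerMatrix q.1)))) (volume.prod (groupMeasure p)) :=
    ((((hφ.fun_mul hw).comp measurable_fst).fun_mul hDW).aemeasurable :)
  have h4 : AEMeasurable (Function.uncurry fun Y q => φ Y * jointDensity g Y *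
      (w (act (-((lowerMatrix q.1)⁻¹ *ᵥ q.2)) (lowerMatrix q.1)⁻¹ Y) *
        ENNReal.ofReal (leftJac (lowerMatrix q.1))⁻¹)) (volume.prod (groupMeasure p)) :=
    ((((hφ.fun_mul hG).comp measurable_fst).fun_mul hIJ).aemeasurable :)
  simp only [h1, h2]
  -- After Tonelli the group element `(a, T)` is fixed and the samples are related by `Y = a + T X`.
  -- Then `w` is evaluated at `X` again, `φ` is unchanged, and the Jacobian `det T ^ n` combines
  -- with `1 / leftJac` into the orbit weight.
  rw [lintegral_lintegral_swap h3, lintegral_lintegral_swap h4]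
  · refine lintegral_congr_ae ?_
    filter_upwards [ae_groupMeasure_mem] with q hq
    have hdet := LT.det_pos hq
    set T := lowerMatrix q.1 with hT
    have hIJq : Measurable fun Y : Fin n → Fin p → ℝ =>
        w (act (-(T⁻¹ *ᵥ q.2)) T⁻¹ Y) * ENNReal.ofReal (leftJac T)⁻¹ := by
      have h5 : Measurable fun Y : Fin n → Fin p → ℝ => (Y, q) := measurable_prodMk_right
      have h6 := hIJ.fun_comp h5
      exact h6
    have hFm : Measurable fun Y => φ Y * jointDensity g Y *
        (w (act (-(T⁻¹ *ᵥ q.2)) T⁻¹ Y) * ENNReal.ofReal (leftJac T)⁻¹) :=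
      (hφ.fun_mul hG).fun_mul hIJq
    have hFc : Measurable fun X => φ (act q.2 T X) * jointDensity g (act q.2 T X) *
        (w (act (-(T⁻¹ *ᵥ q.2)) T⁻¹ (act q.2 T X)) * ENNReal.ofReal (leftJac T)⁻¹) :=
      (hFm.comp (measurable_act q.2 T) :)
    have hc := lintegral_comp_act hdet.ne' q.2 hFm
    have hcancel : ENNReal.ofReal (T.det ^ n) * ENNReal.ofReal (|T.det|⁻¹ ^ n) = 1 := by
      rw [← ENNReal.ofReal_mul (by positivity), abs_of_pos hdet, ← mul_pow,
        mul_inv_cancel₀ hdet.ne', one_pow, ENNReal.ofReal_one]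
    have hc2 := congrArg (fun x => ENNReal.ofReal (T.det ^ n) * x) hc
    simp only [← mul_assoc (ENNReal.ofReal (T.det ^ n)) (ENNReal.ofReal (|T.det|⁻¹ ^ n)), hcancel,
      one_mul] at hc2
    rw [← hc2, ← lintegral_const_mul _ hFc]
    refine lintegral_congr fun X => ?_
    have hX : act (-(T⁻¹ *ᵥ q.2)) T⁻¹ (act q.2 T X) = X := by
      rw [act_act, Matrix.nonsing_inv_mul _ hdet.ne'.isUnit, neg_add_cancel, act_zero_one]
    rw [hX, hinv _ _ hq, orbitWeight_eq hq, ENNReal.ofReal_mul (by positivity)]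
    ring

/-! ### An averaging weight depending on the sample mean and covariance only -/

/-- A weight on the sample space whose average over each orbit is positive and finite. -/
def averagingWeight (X : Fin n → Fin p → ℝ) : ℝ≥0∞ :=
  (Set.Iic (1 : ℝ)).indicator (fun _ => 1) (sampleMean X ⬝ᵥ ((sampleCov X)⁻¹ *ᵥ sampleMean X)) *
    ((Set.Iic (p + 1 : ℝ)).indicator (fun _ => 1) (sampleCov X)⁻¹.trace *
      ENNReal.ofReal (√(sampleCov X)⁻¹.det ^ n))

lemma measurable_indicator_Iic_one (c : ℝ) :
    Measurable ((Set.Iic c).indicator fun _ : ℝ => (1 : ℝ≥0∞)) :=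
  measurable_const.indicator measurableSet_Iic

lemma measurable_averagingWeight : Measurable (averagingWeight (n := n) (p := p)) := by
  have hm : Measurable (sampleMean (n := n) (p := p)) := continuous_sampleMean.measurable
  have hS : ∀ i j, Measurable fun X : Fin n → Fin p → ℝ => (sampleCov X)⁻¹ i j :=
    measurable_inv_apply fun i j => (continuous_sampleCov.matrix_elem i j).measurable
  have h1 : Measurable fun X : Fin n → Fin p → ℝ =>
      sampleMean X ⬝ᵥ ((sampleCov X)⁻¹ *ᵥ sampleMean X) :=
    measurable_dotProduct hm (measurable_mulVec hS hm)
  have h2 : Measurable fun X : Fin n → Fin p → ℝ => (sampleCov X)⁻¹.trace :=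
    Finset.measurable_sum _ fun i _ => hS i i
  have h3 : Measurable fun X : Fin n → Fin p → ℝ => √(sampleCov X)⁻¹.det ^ n :=
    (measurable_det hS).sqrt.pow_const n
  exact ((measurable_indicator_Iic_one 1).fun_comp h1).fun_mul
    (((measurable_indicator_Iic_one (p + 1)).fun_comp h2).fun_mul h3.ennreal_ofReal)

/-- At a standardized sample the three factors of the weight depend on `a` alone or on `T` alone, so
the orbit average splits into a product. The power of the determinant turns the left Haar density
into `orbitWeight`. -/
lemma averagingWeight_act_inv (hn : n ≠ 0) {Z : Fin n → Fin p → ℝ} (hm : sampleMean Z = 0)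
    (hc : sampleCov Z = 1) {T : Matrix (Fin p) (Fin p) ℝ} (hT : T ∈ LT p) (a : Fin p → ℝ) :
    averagingWeight (act (-(T⁻¹ *ᵥ a)) T⁻¹ Z) =
      (Set.Iic (1 : ℝ)).indicator (fun _ => 1) (a ⬝ᵥ a) *
        ((Set.Iic (p + 1 : ℝ)).indicator (fun _ => 1) (Tᵀ * T).trace *
          ENNReal.ofReal (T.det ^ n)) := by
  have hu := LT.isUnit_det hT
  have hmean : sampleMean (act (-(T⁻¹ *ᵥ a)) T⁻¹ Z) = -(T⁻¹ *ᵥ a) := by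
    rw [sampleMean_act hn, hm, Matrix.mulVec_zero, add_zero]
  have hcov : (sampleCov (act (-(T⁻¹ *ᵥ a)) T⁻¹ Z))⁻¹ = Tᵀ * T := by
    rw [sampleCov_act hn, hc, Matrix.mul_one, Matrix.mul_inv_rev, Matrix.nonsing_inv_nonsing_inv _ hu,
      ← Matrix.transpose_nonsing_inv, Matrix.nonsing_inv_nonsing_inv _ hu]
  have hq : -(T⁻¹ *ᵥ a) ⬝ᵥ ((Tᵀ * T) *ᵥ -(T⁻¹ *ᵥ a)) = a ⬝ᵥ a := by
    rw [Matrix.mulVec_neg, neg_dotProduct_neg, Matrix.mulVec_mulVec, Matrix.mul_assoc,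
      Matrix.mul_nonsing_inv _ hu, Matrix.mul_one, Matrix.mulVec_transpose, dotProduct_comm,
      ← Matrix.dotProduct_mulVec, Matrix.mulVec_mulVec, Matrix.mul_nonsing_inv _ hu,
      Matrix.one_mulVec]
  have hd : √(Tᵀ * T).det = T.det := by
    rw [Matrix.det_mul, Matrix.det_transpose, Real.sqrt_mul_self (LT.det_pos hT).le]
  rw [averagingWeight, hmean, hcov, hq, hd]

lemma trace_transpose_mul_self_eq (T : Matrix (Fin p) (Fin p) ℝ) :
    (Tᵀ * T).trace = ∑ j, ∑ i, T i j ^ 2 := by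
  simp [Matrix.trace, Matrix.mul_apply, sq]

lemma abs_apply_le_of_trace_le {T : Matrix (Fin p) (Fin p) ℝ} (h : (Tᵀ * T).trace ≤ p + 1)
    (i j : Fin p) : |T i j| ≤ p + 1 := by
  rw [trace_transpose_mul_self_eq] at h
  have h1 : ∑ i, T i j ^ 2 ≤ ∑ j, ∑ i, T i j ^ 2 :=
    Finset.single_le_sum (f := fun j => ∑ i, T i j ^ 2)
      (fun j _ => Finset.sum_nonneg fun i _ => sq_nonneg _) (Finset.mem_univ j)
  have h2 : T i j ^ 2 ≤ ∑ i, T i j ^ 2 :=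
    Finset.single_le_sum (f := fun i => T i j ^ 2) (fun i _ => sq_nonneg _) (Finset.mem_univ i)
  have hp : (0 : ℝ) ≤ p := p.cast_nonneg
  refine abs_le_of_sq_le_sq ?_ (by positivity)
  nlinarith

lemma orbitWeight_le (hn : p < n) {T : Matrix (Fin p) (Fin p) ℝ} (hT : T ∈ LT p)
    (h : (Tᵀ * T).trace ≤ p + 1) : orbitWeight n T ≤ ∏ _i : Fin p, (p + 1 : ℝ) ^ n := by
  refine Finset.prod_le_prod (fun i _ => (zpow_pos (hT.2 i) _).le) fun i _ => ?_
  -- Since `i < p < n`, the exponent is nonnegative, so the weight stays bounded as diagonal entries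
  -- approach zero.
  have hi : ((n : ℤ) - ((i : ℕ) + 1 : ℤ) - 1) = ((n - ((i : ℕ) + 2) : ℕ) : ℤ) := by omega
  rw [hi, zpow_natCast]
  have h1 : T i i ≤ p + 1 := (le_abs_self _).trans (abs_apply_le_of_trace_le h i i)
  have hp : (0 : ℝ) ≤ p := p.cast_nonneg
  exact (pow_le_pow_left₀ (hT.2 i).le h1 _).trans
    (pow_le_pow_right₀ (by linarith) (by omega))

lemma continuous_trace_lowerMatrix :
    Continuous fun t : LowerIdx p → ℝ => ((lowerMatrix t)ᵀ * lowerMatrix t).trace :=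
  (continuous_lowerMatrix.matrix_transpose.matrix_mul continuous_lowerMatrix).matrix_trace

/-- By invariance the average may be computed at the standardized sample, where only mean zero and
identity covariance matter, so the value is the same on every nonsingular orbit. It is finite
because the indicators confine `a` and `T` to bounded sets on which the weight is bounded. It is
positive because `T = 1`, `a = 0` satisfies both constraints strictly: the trace there is `p < p +
1`. -/
lemma exists_orbitAverage_averagingWeight (hn : p < n) :
    ∃ c : ℝ≥0∞, c ≠ 0 ∧ c ≠ ∞ ∧ ∀ Y : Fin n → Fin p → ℝ, (sampleCov Y).det ≠ 0 →
      orbitAverage averagingWeight Y = c := by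
  set A : (Fin p → ℝ) → ℝ≥0∞ := fun a => (Set.Iic (1 : ℝ)).indicator (fun _ => 1) (a ⬝ᵥ a) with hA
  set D : (LowerIdx p → ℝ) → ℝ≥0∞ := fun t =>
    (Set.Iic (p + 1 : ℝ)).indicator (fun _ => 1) ((lowerMatrix t)ᵀ * lowerMatrix t).trace *
      ENNReal.ofReal (orbitWeight n (lowerMatrix t)) with hD
  have hcA : Continuous fun a : Fin p → ℝ => a ⬝ᵥ a := continuous_id.dotProduct continuous_id
  have hAm : Measurable A := (measurable_indicator_Iic_one 1).fun_comp hcA.measurable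
  have hDm : Measurable D :=
    ((measurable_indicator_Iic_one (p + 1)).fun_comp
      continuous_trace_lowerMatrix.measurable).fun_mul measurable_orbitWeight.ennreal_ofReal
  refine ⟨(∫⁻ t in lowerSet p, D t) * ∫⁻ a, A a, mul_ne_zero ?_ ?_, ENNReal.mul_ne_top ?_ ?_,
    fun Y hY => ?_⟩
  · refine ((setLIntegral_pos_iff hDm).2 ?_).ne'
    have ho : IsOpen ({t : LowerIdx p → ℝ | ((lowerMatrix t)ᵀ * lowerMatrix t).trace < p + 1} ∩
        lowerSet p) :=
      (isOpen_lt continuous_trace_lowerMatrix continuous_const).inter isOpen_lowerSet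
    have hne : ({t : LowerIdx p → ℝ | ((lowerMatrix t)ᵀ * lowerMatrix t).trace < p + 1} ∩
        lowerSet p).Nonempty := by
      have h1 := lowerMatrix_lowerEntries (LT.lower (LT.one (p := p)))
      refine ⟨lowerEntries 1, ?_, ?_⟩
      · simp [h1]
      · change lowerMatrix _ ∈ LT p
        rw [h1]; exact LT.one
    refine (ho.measure_pos volume hne).trans_le (measure_mono fun t ht => ⟨?_, ht.2⟩)
    have h1 : ((lowerMatrix t)ᵀ * lowerMatrix t).trace ∈ Set.Iic (p + 1 : ℝ) :=
      Set.mem_Iic.2 (le_of_lt ht.1)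
    simp only [Function.mem_support, hD, Set.indicator_of_mem h1, one_mul]
    exact (ENNReal.ofReal_pos.2 (orbitWeight_pos ht.2)).ne'
  · refine ((lintegral_pos_iff_support hAm).2 ?_).ne'
    have ho : IsOpen {a : Fin p → ℝ | a ⬝ᵥ a < 1} := isOpen_lt hcA continuous_const
    refine (ho.measure_pos volume ⟨0, by simp⟩).trans_le (measure_mono fun a ha => ?_)
    have h1 : a ⬝ᵥ a ∈ Set.Iic (1 : ℝ) := Set.mem_Iic.2 (le_of_lt ha)
    simp [hA, Set.indicator_of_mem h1]
  · set C : ℝ≥0∞ := ENNReal.ofReal (∏ _i : Fin p, (p + 1 : ℝ) ^ n)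
    have hb : ∫⁻ t in lowerSet p, D t ≤
        ∫⁻ t, (Metric.closedBall (0 : LowerIdx p → ℝ) (p + 1)).indicator (fun _ => C) t := by
      refine (setLIntegral_mono' measurableSet_lowerSet fun t ht => ?_).trans
        (setLIntegral_le_lintegral _ _)
      by_cases h : ((lowerMatrix t)ᵀ * lowerMatrix t).trace ∈ Set.Iic (p + 1 : ℝ)
      · have hmem : t ∈ Metric.closedBall (0 : LowerIdx p → ℝ) (p + 1) := by
          rw [mem_closedBall_zero_iff, pi_norm_le_iff_of_nonneg (by positivity)]
          intro x
          have := abs_apply_le_of_trace_le h x.1.1 x.1.2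
          rwa [lowerMatrix_apply_of_le t x.2] at this
        rw [Set.indicator_of_mem hmem]
        simp only [hD, Set.indicator_of_mem h, one_mul]
        exact ENNReal.ofReal_le_ofReal (orbitWeight_le hn ht h)
      · simp [hD, Set.indicator_of_notMem h]
    refine ne_top_of_le_ne_top ?_ hb
    rw [lintegral_indicator_const Metric.isClosed_closedBall.measurableSet]
    exact ENNReal.mul_ne_top ENNReal.ofReal_ne_top measure_closedBall_lt_top.ne
  · have hb : ∫⁻ a, A a ≤
        ∫⁻ a, (Metric.closedBall (0 : Fin p → ℝ) 1).indicator (fun _ => 1) a := by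
      refine lintegral_mono fun a => ?_
      by_cases h : a ⬝ᵥ a ∈ Set.Iic (1 : ℝ)
      · have hmem : a ∈ Metric.closedBall (0 : Fin p → ℝ) 1 := by
          rw [mem_closedBall_zero_iff, pi_norm_le_iff_of_nonneg zero_le_one]
          intro i
          have h1 : a i * a i ≤ a ⬝ᵥ a :=
            Finset.single_le_sum (f := fun i => a i * a i) (fun i _ => mul_self_nonneg _)
              (Finset.mem_univ i)
          refine abs_le_of_sq_le_sq ?_ zero_le_one
          have h2 : a ⬝ᵥ a ≤ 1 := h
          nlinarith
        rw [Set.indicator_of_mem hmem]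
        simp [hA, Set.indicator_of_mem h]
      · simp [hA, Set.indicator_of_notMem h]
    refine ne_top_of_le_ne_top ?_ hb
    rw [lintegral_indicator_const Metric.isClosed_closedBall.measurableSet]
    exact ENNReal.mul_ne_top ENNReal.one_ne_top measure_closedBall_lt_top.ne
  · have hn0 : n ≠ 0 := by omega
    obtain ⟨U, hU, hS⟩ := exists_cholesky_sampleCov hY
    have hu := LT.isUnit_det hU
    rw [← act_standardize hu Y, orbitAverage_act measurable_averagingWeight hU, orbitAverage,
      ← lintegral_prod_mul hDm.aemeasurable hAm.aemeasurable]
    refine lintegral_congr_ae ?_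
    filter_upwards [ae_groupMeasure_mem] with q hq
    rw [averagingWeight_act_inv hn0 (sampleMean_standardize hn0 U Y)
      (sampleCov_standardize hn0 hu hS) hq, mul_comm (D q.1)]
    simp only [hA, hD, orbitWeight_eq (n := n) hq,
      ENNReal.ofReal_mul (pow_pos (LT.det_pos hq) n).le]
    ring

/-! ### The ratio of orbit integrals as a likelihood ratio. -/

lemma orbitIntegral_ne_zero {g : (Fin p → ℝ) → ℝ} (hg : Measurable g) (hpos : ∀ x, 0 < g x)
    (X : Fin n → Fin p → ℝ) : orbitIntegral g X ≠ 0 := by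
  have hm : Measurable fun q : (LowerIdx p → ℝ) × (Fin p → ℝ) =>
      jointDensity g (act q.2 (lowerMatrix q.1) X) *
        ENNReal.ofReal (orbitWeight n (lowerMatrix q.1)) :=
    (((measurable_jointDensity_act hg).comp (measurable_prodMk_left (x := X))).fun_mul
      (measurable_orbitWeight.comp measurable_fst).ennreal_ofReal :)
  intro h0
  rw [orbitIntegral_eq hg, lintegral_eq_zero_iff hm] at h0
  have hF : ∀ᵐ q ∂(groupMeasure p), False := by
    filter_upwards [h0, ae_groupMeasure_mem] with q hq hq'
    refine mul_ne_zero ?_ ?_ hq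
    · exact (ENNReal.ofReal_pos.2 (Finset.prod_pos fun i _ => hpos _)).ne'
    · exact (ENNReal.ofReal_pos.2 (orbitWeight_pos hq')).ne'
  have hne : (lowerSet p).Nonempty :=
    ⟨lowerEntries 1, by
      change lowerMatrix _ ∈ LT p
      rw [lowerMatrix_lowerEntries (LT.lower LT.one)]; exact LT.one⟩
  have h1 : groupMeasure p (Set.univ) = 0 := by simpa [ae_iff] using hF
  rw [groupMeasure, ← Set.univ_prod_univ, Measure.prod_prod, Measure.restrict_apply_univ] at h1
  exact mul_ne_zero (isOpen_lowerSet.measure_pos volume hne).ne'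
    (isOpen_univ.measure_pos volume Set.univ_nonempty).ne' h1

lemma ratio_act {g₀ g₁ : (Fin p → ℝ) → ℝ} (hg₀ : Measurable g₀) (hg₁ : Measurable g₁)
    (a : Fin p → ℝ) {T : Matrix (Fin p) (Fin p) ℝ} (hT : T ∈ LT p) (X : Fin n → Fin p → ℝ) :
    ratio g₁ g₀ (act a T X) = ratio g₁ g₀ X := by
  obtain ⟨m, h0, hi, h⟩ := exists_orbitIntegral_act (n := n) hT
  rw [ratio, h a g₁ hg₁, h a g₀ hg₀, ratio, ENNReal.mul_div_mul_left _ _ h0 hi]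

lemma measurable_ratio {g₀ g₁ : (Fin p → ℝ) → ℝ} (hg₀ : Measurable g₀) (hg₁ : Measurable g₁) :
    Measurable (ratio (n := n) g₁ g₀) :=
  (measurable_orbitIntegral hg₁).div (measurable_orbitIntegral hg₀)

/-- The likelihood ratio of the maximal invariant: expectations of invariant functions under the
two densities are related by the ratio of the orbit integrals. -/
theorem lintegral_invariant_mul_ratio (hn : p < n) {g₀ g₁ : (Fin p → ℝ) → ℝ}
    (hg₀ : Measurable g₀) (hpos : ∀ x, 0 < g₀ x) (hg₁ : Measurable g₁)
    (hfin : ∫⁻ X : Fin n → Fin p → ℝ, jointDensity g₀ X ≠ ∞) :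
    (∀ φ : (Fin n → Fin p → ℝ) → ℝ≥0∞, Measurable φ →
      (∀ (a : Fin p → ℝ), ∀ T ∈ LT p, ∀ X, φ (act a T X) = φ X) →
      ∫⁻ X, φ X * ratio g₁ g₀ X * jointDensity g₀ X = ∫⁻ X, φ X * jointDensity g₁ X) ∧
    ∀ᵐ X : Fin n → Fin p → ℝ, orbitIntegral g₀ X ≠ ∞ := by
  obtain ⟨c, hc0, hci, hc⟩ := exists_orbitAverage_averagingWeight hn
  have hw := measurable_averagingWeight (n := n) (p := p)
  have key : ∀ g : (Fin p → ℝ) → ℝ, Measurable g → ∀ φ : (Fin n → Fin p → ℝ) → ℝ≥0∞,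
      Measurable φ → (∀ (a : Fin p → ℝ), ∀ T ∈ LT p, ∀ X, φ (act a T X) = φ X) →
      ∫⁻ X, φ X * averagingWeight X * orbitIntegral g X =
        (∫⁻ X, φ X * jointDensity g X) * c := by
    intro g hg φ hφ hinv
    rw [lintegral_mul_orbitIntegral hg hφ hw hinv,
      ← lintegral_mul_const _ (hφ.fun_mul (measurable_jointDensity hg))]
    refine lintegral_congr_ae ?_
    filter_upwards [ae_det_sampleCov_ne_zero hn] with Y hY
    rw [hc Y hY]
  have hI0 := measurable_orbitIntegral (n := n) hg₀
  have hG0 := measurable_jointDensity (n := n) hg₀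
  -- The orbit integral is not known to be finite yet. The identity for `φ = 1` makes its product
  -- with the weight integrable, so the weight vanishes almost everywhere that it is infinite.
  have hw0 : ∀ᵐ X : Fin n → Fin p → ℝ, orbitIntegral g₀ X = ∞ → averagingWeight X = 0 := by
    have h1 := key g₀ hg₀ (fun _ => 1) measurable_const fun _ _ _ _ => rfl
    simp only [one_mul] at h1
    have h2 := ae_lt_top (hw.fun_mul hI0) (by rw [h1]; exact ENNReal.mul_ne_top hfin hci)
    filter_upwards [h2] with X hX hXi
    by_contra h
    rw [hXi, ENNReal.mul_top h] at hX
    exact lt_irrefl _ hX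
  refine ⟨fun φ hφ hinv => ?_, ?_⟩
  · have hr : Measurable fun X : Fin n → Fin p → ℝ => φ X * ratio g₁ g₀ X :=
      hφ.fun_mul (measurable_ratio hg₀ hg₁)
    have h1 := key g₀ hg₀ _ hr fun a T hT X => by rw [hinv a T hT, ratio_act hg₀ hg₁ a hT]
    rw [← ENNReal.mul_left_inj hc0 hci, ← h1, ← key g₁ hg₁ φ hφ hinv]
    refine lintegral_congr_ae ?_
    filter_upwards [hw0] with X hX
    by_cases h : orbitIntegral g₀ X = ∞
    · simp [hX h]
    · have h2 : ratio g₁ g₀ X * orbitIntegral g₀ X = orbitIntegral g₁ X :=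
        ENNReal.div_mul_cancel (orbitIntegral_ne_zero hg₀ hpos X) h
      rw [← h2]
      ring
  -- The set where the orbit integral is infinite is invariant, so its indicator may serve as `φ`.
  -- The weighted side vanishes and `c ≠ 0`, so the set is null for the positive density `g₀`.
  · set s : Set (Fin n → Fin p → ℝ) := {X | orbitIntegral g₀ X = ∞} with hs
    have hsm : MeasurableSet s := hI0 (measurableSet_singleton ∞)
    have hφ : Measurable (s.indicator fun _ => (1 : ℝ≥0∞)) := measurable_const.indicator hsm
    have h1 := key g₀ hg₀ _ hφ fun a T hT X => by
      obtain ⟨m, h0, hi, h⟩ := exists_orbitIntegral_act (n := n) hT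
      have : act a T X ∈ s ↔ X ∈ s := by
        simp [hs, h a g₀ hg₀, ENNReal.mul_eq_top, h0, hi]
      by_cases hX : X ∈ s
      · rw [Set.indicator_of_mem hX, Set.indicator_of_mem (this.2 hX)]
      · rw [Set.indicator_of_notMem hX, Set.indicator_of_notMem (mt this.1 hX)]
    have h2 : ∫⁻ X, s.indicator (fun _ => (1 : ℝ≥0∞)) X * averagingWeight X * orbitIntegral g₀ X =
        0 := by
      rw [lintegral_eq_zero_iff ((hφ.fun_mul hw).fun_mul hI0)]
      filter_upwards [hw0] with X hX
      by_cases h : X ∈ s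
      · simp [hX h]
      · simp [Set.indicator_of_notMem h]
    rw [h2] at h1
    have h3 := (mul_eq_zero.1 h1.symm).resolve_right hc0
    rw [lintegral_eq_zero_iff (hφ.fun_mul hG0)] at h3
    filter_upwards [h3] with X hX h
    have h4 : X ∈ s := h
    simp only [Set.indicator_of_mem h4, one_mul] at hX
    exact (ENNReal.ofReal_pos.2 (Finset.prod_pos fun i _ => hpos _)).ne' hX

/-! ### The law of the sample -/

lemma lintegral_fin_prod {E : Type*} [MeasureSpace E] [SigmaFinite (volume : Measure E)] :
    ∀ (n : ℕ) (F : Fin n → E → ℝ≥0∞), (∀ i, Measurable (F i)) →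
      ∫⁻ X : Fin n → E, ∏ i, F i (X i) = ∏ i, ∫⁻ x, F i x
  | 0, F, _ => by
    simp [volume_pi]
  | n + 1, F, hF => by
    have hmp := (volume_preserving_piFinSuccAbove (fun _ : Fin (n + 1) => E) 0).symm
    have hm : Measurable fun X : Fin (n + 1) → E => ∏ i, F i (X i) :=
      Finset.measurable_prod _ fun i _ => (hF i).comp (measurable_pi_apply i)
    have hm' : Measurable fun X : Fin n → E => ∏ i : Fin n, F i.succ (X i) :=
      Finset.measurable_prod _ fun i _ => (hF _).comp (measurable_pi_apply i)
    rw [← hmp.lintegral_comp hm, Fin.prod_univ_succ, ← lintegral_fin_prod n _ fun i => hF i.succ,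
      ← lintegral_prod_mul (hF 0).aemeasurable hm'.aemeasurable]
    refine lintegral_congr fun q => ?_
    rw [Fin.prod_univ_succ]
    rfl

lemma IsDensity.isProbabilityMeasure {g : (Fin p → ℝ) → ℝ} (hg : IsDensity g) :
    IsProbabilityMeasure
      ((volume : Measure (Fin p → ℝ)).withDensity fun x => ENNReal.ofReal (g x)) :=
  ⟨by rw [withDensity_apply _ MeasurableSet.univ, setLIntegral_univ, hg.lintegral_eq_one]⟩

lemma affineDensity_zero_one (g : (Fin p → ℝ) → ℝ) : affineDensity g 0 1 = g := by
  funext x; simp [affineDensity]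

lemma sampleLaw_zero_one {g : (Fin p → ℝ) → ℝ} (hg : IsDensity g) :
    sampleLaw n g 0 1 = volume.withDensity (jointDensity g) := by
  have := IsDensity.isProbabilityMeasure hg
  rw [sampleLaw, affineDensity_zero_one]
  refine Measure.pi_eq fun s hs => ?_
  rw [withDensity_apply _ (MeasurableSet.univ_pi hs), ← lintegral_indicator (MeasurableSet.univ_pi hs)]
  have h : ∀ X : Fin n → Fin p → ℝ, (Set.univ.pi s).indicator (jointDensity g) X =
      ∏ i, (s i).indicator (fun x => ENNReal.ofReal (g x)) (X i) := by
    intro X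
    by_cases hX : X ∈ Set.univ.pi s
    · rw [Set.indicator_of_mem hX, jointDensity, ENNReal.ofReal_prod_of_nonneg fun i _ => hg.nonneg _]
      exact Finset.prod_congr rfl fun i _ => by rw [Set.indicator_of_mem (hX i trivial)]
    · rw [Set.indicator_of_notMem hX]
      simp only [Set.mem_pi, Set.mem_univ, true_implies, not_forall] at hX
      obtain ⟨i, hi⟩ := hX
      exact (Finset.prod_eq_zero (Finset.mem_univ i) (Set.indicator_of_notMem hi _)).symm
  simp only [h]
  rw [lintegral_fin_prod n _ fun i => hg.measurable.ennreal_ofReal.indicator (hs i)]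
  refine Finset.prod_congr rfl fun i _ => ?_
  rw [withDensity_apply _ (hs i), lintegral_indicator (hs i)]

lemma isProbabilityMeasure_sampleLaw {g : (Fin p → ℝ) → ℝ} (hg : IsDensity g) :
    IsProbabilityMeasure (sampleLaw n g 0 1) := by
  have := IsDensity.isProbabilityMeasure hg
  rw [sampleLaw, affineDensity_zero_one]
  infer_instance

lemma map_affine_withDensity {g : (Fin p → ℝ) → ℝ} (hg : IsDensity g)
    {B : Matrix (Fin p) (Fin p) ℝ} (hB : B.det ≠ 0) (a : Fin p → ℝ) :
    ((volume : Measure (Fin p → ℝ)).withDensity fun x => ENNReal.ofReal (g x)).map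
        (fun x => a + B *ᵥ x) =
      volume.withDensity fun x => ENNReal.ofReal (affineDensity g a B x) := by
  have hgB : Measurable fun x => ENNReal.ofReal (g (B⁻¹ *ᵥ (x - a))) := by
    have h1 : Measurable fun x : Fin p → ℝ => B⁻¹ *ᵥ (x - a) :=
      measurable_mulVec (fun _ _ => measurable_const) (measurable_id.sub_const a)
    exact (hg.measurable.fun_comp h1).ennreal_ofReal
  ext s hs
  have hpre := measurable_affine B a hs
  have h := lintegral_comp_affine hB a (hgB.indicator hs)
  rw [Measure.map_apply (measurable_affine B a) hs, withDensity_apply _ hpre, withDensity_apply _ hs,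
    ← lintegral_indicator hpre]
  calc _ = ∫⁻ x, s.indicator (fun x => ENNReal.ofReal (g (B⁻¹ *ᵥ (x - a)))) (a + B *ᵥ x) := by
        refine lintegral_congr fun x => ?_
        have hx : B⁻¹ *ᵥ (a + B *ᵥ x - a) = x := by
          rw [add_sub_cancel_left, Matrix.mulVec_mulVec, Matrix.nonsing_inv_mul _ hB.isUnit,
            Matrix.one_mulVec]
        by_cases hxs : a + B *ᵥ x ∈ s
        · rw [Set.indicator_of_mem hxs, Set.indicator_of_mem (show x ∈ _ from hxs), hx]
        · rw [Set.indicator_of_notMem hxs, Set.indicator_of_notMem (show x ∉ _ from hxs)]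
    _ = _ := by
        rw [h, lintegral_indicator hs, ← lintegral_const_mul _ hgB]
        refine lintegral_congr fun x => ?_
        rw [affineDensity, one_div, ENNReal.ofReal_mul (by positivity)]

lemma sampleLaw_eq_map {g : (Fin p → ℝ) → ℝ} (hg : IsDensity g)
    {B : Matrix (Fin p) (Fin p) ℝ} (hB : B.det ≠ 0) (a : Fin p → ℝ) :
    sampleLaw n g a B = (sampleLaw n g 0 1).map (act a B) := by
  have := IsDensity.isProbabilityMeasure hg
  have h2 : IsProbabilityMeasure (((volume : Measure (Fin p → ℝ)).withDensity
      fun x => ENNReal.ofReal (g x)).map (fun x => a + B *ᵥ x)) :=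
    Measure.isProbabilityMeasure_map (measurable_affine B a).aemeasurable
  rw [sampleLaw, sampleLaw, affineDensity_zero_one, ← map_affine_withDensity hg hB]
  exact (Measure.pi_map_pi fun _ => (measurable_affine B a).aemeasurable).symm

/-- The density involves `B` only through `|det B|` and the quadratic form of `(B Bᵀ)⁻¹`, both
functions of `B Bᵀ`. -/
lemma sampleLaw_congr_of_isSpherical {g : (Fin p → ℝ) → ℝ} (hg : IsSpherical g)
    {B T : Matrix (Fin p) (Fin p) ℝ} (h : B * Bᵀ = T * Tᵀ) (a : Fin p → ℝ) :
    sampleLaw n g a B = sampleLaw n g a T := by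
  obtain ⟨h₀, hh⟩ := hg
  have hdet : |B.det| = |T.det| := by
    have := congrArg Matrix.det h
    rw [Matrix.det_mul, Matrix.det_mul, Matrix.det_transpose, Matrix.det_transpose] at this
    rw [← Real.sqrt_mul_self_eq_abs, ← Real.sqrt_mul_self_eq_abs, this]
  have hq : ∀ (C : Matrix (Fin p) (Fin p) ℝ) (y : Fin p → ℝ),
      (C⁻¹ *ᵥ y) ⬝ᵥ (C⁻¹ *ᵥ y) = y ⬝ᵥ ((C * Cᵀ)⁻¹ *ᵥ y) := by
    intro C y
    rw [Matrix.mul_inv_rev, ← Matrix.mulVec_mulVec, ← Matrix.transpose_nonsing_inv,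
      Matrix.dotProduct_mulVec y, Matrix.vecMul_transpose]
  have : affineDensity g a B = affineDensity g a T := by
    funext x
    rw [affineDensity, affineDensity, hh, hh, hq, hq, h, hdet]
  rw [sampleLaw, sampleLaw, this]

lemma integral_sampleLaw_of_lower {g : (Fin p → ℝ) → ℝ} (hg : IsDensity g)
    {φ : (Fin n → Fin p → ℝ) → ℝ} (hφ : IsInvariantTest φ) (a : Fin p → ℝ)
    {T : Matrix (Fin p) (Fin p) ℝ} (hT : T ∈ LT p) :
    ∫ X, φ X ∂(sampleLaw n g a T) = ∫ X, φ X ∂(sampleLaw n g 0 1) := by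
  rw [sampleLaw_eq_map hg (LT.det_pos hT).ne', integral_map (measurable_act a T).aemeasurable
    hφ.measurable.aestronglyMeasurable]
  exact integral_congr_ae (Filter.Eventually.of_forall fun X => hφ.invariant a T hT X)

/-- Invariant tests have constant power on the alternative. -/
lemma integral_sampleLaw_of_mem_altScales {g : (Fin p → ℝ) → ℝ} (hg : IsDensity g)
    {φ : (Fin n → Fin p → ℝ) → ℝ} (hφ : IsInvariantTest φ) (a : Fin p → ℝ)
    {B : Matrix (Fin p) (Fin p) ℝ} (hB : B ∈ altScales g) :
    ∫ X, φ X ∂(sampleLaw n g a B) = ∫ X, φ X ∂(sampleLaw n g 0 1) := by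
  rcases hB with ⟨hdet, hT | hs⟩
  · exact integral_sampleLaw_of_lower hg hφ a hT
  · obtain ⟨T, hT, h⟩ := exists_lower_mul_transpose_eq hdet
    rw [sampleLaw_congr_of_isSpherical hs h a, integral_sampleLaw_of_lower hg hφ a hT]

lemma one_mem_altScales (g : (Fin p → ℝ) → ℝ) : (1 : Matrix (Fin p) (Fin p) ℝ) ∈ altScales g :=
  ⟨by simp, Or.inl LT.one⟩

lemma isSpherical_stdNormalDensity : IsSpherical (stdNormalDensity (p := p)) :=
  ⟨fun r => (2 * Real.pi) ^ (-(p : ℝ) / 2) * Real.exp (-r / 2), fun _ => rfl⟩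

lemma stdNormalDensity_pos (x : Fin p → ℝ) : 0 < stdNormalDensity x := by
  unfold stdNormalDensity; positivity

/-! ### The critical region -/

/-- The standardized sample lies on the orbit of `X` and the ratio is invariant, so the ratio may be
evaluated at `X` itself. Uniqueness of the Cholesky root is not needed. -/
lemma exists_cholesky_ratio_iff {g₀ g₁ : (Fin p → ℝ) → ℝ} (hg₀ : Measurable g₀)
    (hg₁ : Measurable g₁) (X : Fin n → Fin p → ℝ) (Q : ℝ≥0∞ → Prop) :
    (∃ T ∈ LT p, sampleCov X = T * Tᵀ ∧ Q (ratio g₁ g₀ (standardize T X))) ↔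
      (sampleCov X).det ≠ 0 ∧ Q (ratio g₁ g₀ X) := by
  have hr : ∀ T ∈ LT p, ratio g₁ g₀ (standardize T X) = ratio g₁ g₀ X := fun T hT => by
    rw [standardize_eq_act, ratio_act hg₀ hg₁ _ (LT.inv hT)]
  constructor
  · rintro ⟨T, hT, hS, hQ⟩
    rw [hr T hT] at hQ
    exact ⟨hS ▸ det_mul_transpose_ne_zero (LT.det_pos hT).ne', hQ⟩
  · rintro ⟨hd, hQ⟩
    obtain ⟨T, hT, hS⟩ := exists_cholesky_sampleCov hd
    exact ⟨T, hT, hS, by rwa [hr T hT]⟩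

lemma mem_criticalRegion {g₀ g₁ : (Fin p → ℝ) → ℝ} (hg₀ : Measurable g₀) (hg₁ : Measurable g₁)
    {k : ℝ} {X : Fin n → Fin p → ℝ} : X ∈ criticalRegion g₁ g₀ k ↔
      (sampleCov X).det ≠ 0 ∧ ENNReal.ofReal k < ratio g₁ g₀ X :=
  exists_cholesky_ratio_iff hg₀ hg₁ X fun r => ENNReal.ofReal k < r

lemma mem_criticalBoundary {g₀ g₁ : (Fin p → ℝ) → ℝ} (hg₀ : Measurable g₀) (hg₁ : Measurable g₁)
    {k : ℝ} {X : Fin n → Fin p → ℝ} : X ∈ criticalBoundary g₁ g₀ k ↔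
      (sampleCov X).det ≠ 0 ∧ ratio g₁ g₀ X = ENNReal.ofReal k :=
  exists_cholesky_ratio_iff hg₀ hg₁ X fun r => r = ENNReal.ofReal k

lemma measurableSet_criticalRegion {g₀ g₁ : (Fin p → ℝ) → ℝ} (hg₀ : Measurable g₀)
    (hg₁ : Measurable g₁) (k : ℝ) :
    MeasurableSet (criticalRegion g₁ g₀ k : Set (Fin n → Fin p → ℝ)) := by
  have : (criticalRegion g₁ g₀ k : Set (Fin n → Fin p → ℝ)) =
      {X | (sampleCov X).det ≠ 0} ∩ ratio g₁ g₀ ⁻¹' Set.Ioi (ENNReal.ofReal k) :=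
    Set.ext fun X => mem_criticalRegion hg₀ hg₁
  rw [this]
  exact measurableSet_det_sampleCov_ne_zero.inter (measurable_ratio hg₀ hg₁ measurableSet_Ioi)

lemma measurableSet_criticalBoundary {g₀ g₁ : (Fin p → ℝ) → ℝ} (hg₀ : Measurable g₀)
    (hg₁ : Measurable g₁) (k : ℝ) :
    MeasurableSet (criticalBoundary g₁ g₀ k : Set (Fin n → Fin p → ℝ)) := by
  have : (criticalBoundary g₁ g₀ k : Set (Fin n → Fin p → ℝ)) =
      {X | (sampleCov X).det ≠ 0} ∩ ratio g₁ g₀ ⁻¹' {ENNReal.ofReal k} :=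
    Set.ext fun X => mem_criticalBoundary hg₀ hg₁
  rw [this]
  exact measurableSet_det_sampleCov_ne_zero.inter
    (measurable_ratio hg₀ hg₁ (measurableSet_singleton _))

lemma disjoint_criticalRegion_criticalBoundary {g₀ g₁ : (Fin p → ℝ) → ℝ} (hg₀ : Measurable g₀)
    (hg₁ : Measurable g₁) (k : ℝ) :
    Disjoint (criticalRegion g₁ g₀ k : Set (Fin n → Fin p → ℝ)) (criticalBoundary g₁ g₀ k) := by
  refine Set.disjoint_left.2 fun X h1 h2 => ?_
  rw [mem_criticalRegion hg₀ hg₁] at h1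
  rw [mem_criticalBoundary hg₀ hg₁] at h2
  exact h1.2.ne h2.2.symm

lemma ratioTest_of_mem_region {g₀ g₁ : (Fin p → ℝ) → ℝ} (hg₀ : Measurable g₀)
    (hg₁ : Measurable g₁) {k γ : ℝ} {X : Fin n → Fin p → ℝ} (hX : X ∈ criticalRegion g₁ g₀ k) :
    ratioTest g₁ g₀ k γ X = 1 := by
  have h := Set.disjoint_left.1 (disjoint_criticalRegion_criticalBoundary hg₀ hg₁ k) hX
  rw [ratioTest, Set.indicator_of_mem hX, Set.indicator_of_notMem h, add_zero]

lemma ratioTest_of_mem_boundary {g₀ g₁ : (Fin p → ℝ) → ℝ} (hg₀ : Measurable g₀)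
    (hg₁ : Measurable g₁) {k γ : ℝ} {X : Fin n → Fin p → ℝ} (hX : X ∈ criticalBoundary g₁ g₀ k) :
    ratioTest g₁ g₀ k γ X = γ := by
  have h := Set.disjoint_right.1 (disjoint_criticalRegion_criticalBoundary hg₀ hg₁ k) hX
  rw [ratioTest, Set.indicator_of_notMem h, Set.indicator_of_mem hX, zero_add]

lemma ratioTest_of_notMem {g₀ g₁ : (Fin p → ℝ) → ℝ} {k γ : ℝ} {X : Fin n → Fin p → ℝ}
    (h1 : X ∉ criticalRegion g₁ g₀ k) (h2 : X ∉ criticalBoundary g₁ g₀ k) :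
    ratioTest g₁ g₀ k γ X = 0 := by
  rw [ratioTest, Set.indicator_of_notMem h1, Set.indicator_of_notMem h2, zero_add]

lemma isInvariantTest_ratioTest (hn : n ≠ 0) {g₀ g₁ : (Fin p → ℝ) → ℝ} (hg₀ : Measurable g₀)
    (hg₁ : Measurable g₁) (k : ℝ) {γ : ℝ} (hγ : γ ∈ Set.Icc (0 : ℝ) 1) :
    IsInvariantTest (n := n) (ratioTest g₁ g₀ k γ) where
  measurable := (measurable_const.indicator (measurableSet_criticalRegion hg₀ hg₁ k)).fun_add
    (measurable_const.indicator (measurableSet_criticalBoundary hg₀ hg₁ k))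
  mem_Icc X := by
    by_cases h1 : X ∈ criticalRegion g₁ g₀ k
    · rw [ratioTest_of_mem_region hg₀ hg₁ h1]; simp
    by_cases h2 : X ∈ criticalBoundary g₁ g₀ k
    · rw [ratioTest_of_mem_boundary hg₀ hg₁ h2]; exact hγ
    · rw [ratioTest_of_notMem h1 h2]; simp
  invariant a T hT X := by
    have h1 : act a T X ∈ criticalRegion g₁ g₀ k ↔ X ∈ criticalRegion g₁ g₀ k := by
      rw [mem_criticalRegion hg₀ hg₁, mem_criticalRegion hg₀ hg₁, ratio_act hg₀ hg₁ a hT,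
        det_sampleCov_act hn a (LT.det_pos hT).ne']
    have h2 : act a T X ∈ criticalBoundary g₁ g₀ k ↔ X ∈ criticalBoundary g₁ g₀ k := by
      rw [mem_criticalBoundary hg₀ hg₁, mem_criticalBoundary hg₀ hg₁, ratio_act hg₀ hg₁ a hT,
        det_sampleCov_act hn a (LT.det_pos hT).ne']
    classical
    simp only [ratioTest, Set.indicator_apply, h1, h2]

lemma integral_ratioTest {g₀ g₁ : (Fin p → ℝ) → ℝ} (hg₀ : Measurable g₀) (hg₁ : Measurable g₁)
    (k γ : ℝ) (P : Measure (Fin n → Fin p → ℝ)) [IsFiniteMeasure P] :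
    ∫ X, ratioTest g₁ g₀ k γ X ∂P =
      P.real (criticalRegion g₁ g₀ k) + γ * P.real (criticalBoundary g₁ g₀ k) := by
  have h1 := measurableSet_criticalRegion (n := n) hg₀ hg₁ k
  have h2 := measurableSet_criticalBoundary (n := n) hg₀ hg₁ k
  simp only [ratioTest]
  rw [integral_add ((integrable_const _).indicator h1) ((integrable_const _).indicator h2),
    integral_indicator_const _ h1, integral_indicator_const _ h2]
  simp [mul_comm]

lemma ratioTest_zero (g₀ g₁ : (Fin p → ℝ) → ℝ) (k : ℝ) :
    ratioTest (n := n) g₁ g₀ k 0 = (criticalRegion g₁ g₀ k).indicator fun _ => 1 := by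
  funext X; simp [ratioTest]

/-! ### The Neyman–Pearson lemma -/

/-- The classical argument integrates `(φ - ψ)(ℓ - k) ≥ 0`. The function `ℓ` need not be a density
of `P₁`: it has to reproduce only the `P₁`-integrals of the two tests compared, which is what holds
for invariant tests. -/
lemma neyman_pearson {Ω : Type*} [MeasurableSpace Ω] {P₀ P₁ : Measure Ω} [IsProbabilityMeasure P₀]
    {ℓ φ ψ : Ω → ℝ} {k : ℝ} (hk : 0 ≤ k) (hℓ : Integrable ℓ P₀)
    (hφm : Measurable φ) (hψm : Measurable ψ) (hφ01 : ∀ x, φ x ∈ Set.Icc (0 : ℝ) 1)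
    (hψ01 : ∀ x, ψ x ∈ Set.Icc (0 : ℝ) 1)
    (hφ : ∫ x, φ x ∂P₁ = ∫ x, φ x * ℓ x ∂P₀) (hψ : ∫ x, ψ x ∂P₁ = ∫ x, ψ x * ℓ x ∂P₀)
    (hgt : ∀ᵐ x ∂P₀, k < ℓ x → φ x = 1) (hlt : ∀ᵐ x ∂P₀, ℓ x < k → φ x = 0)
    (hle : ∫ x, ψ x ∂P₀ ≤ ∫ x, φ x ∂P₀) :
    ∫ x, ψ x ∂P₁ ≤ ∫ x, φ x ∂P₁ ∧ (∫ x, φ x ∂P₁ ≤ ∫ x, ψ x ∂P₁ →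
      (∀ᵐ x ∂P₀, ℓ x ≠ k → ψ x = φ x) ∧ (0 < k → ∫ x, ψ x ∂P₀ = ∫ x, φ x ∂P₀)) := by
  have hbd : ∀ {χ : Ω → ℝ}, (∀ x, χ x ∈ Set.Icc (0 : ℝ) 1) → ∀ᵐ x ∂P₀, ‖χ x‖ ≤ 1 := fun h =>
    Filter.Eventually.of_forall fun x => by
      rw [Real.norm_of_nonneg (h x).1]; exact (h x).2
  have iφ : Integrable φ P₀ := Integrable.of_bound hφm.aestronglyMeasurable 1 (hbd hφ01)
  have iψ : Integrable ψ P₀ := Integrable.of_bound hψm.aestronglyMeasurable 1 (hbd hψ01)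
  have iφℓ : Integrable (fun x => φ x * ℓ x) P₀ :=
    hℓ.bdd_mul hφm.aestronglyMeasurable (hbd hφ01)
  have iψℓ : Integrable (fun x => ψ x * ℓ x) P₀ :=
    hℓ.bdd_mul hψm.aestronglyMeasurable (hbd hψ01)
  have hD0 : ∀ᵐ x ∂P₀, 0 ≤ (φ x - ψ x) * (ℓ x - k) := by
    filter_upwards [hgt, hlt] with x h1 h2
    rcases lt_trichotomy (ℓ x) k with h | h | h
    · rw [h2 h]
      have := (hψ01 x).1
      nlinarith
    · simp [h]
    · rw [h1 h]
      have := (hψ01 x).2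
      nlinarith
  have hexp : ∀ x, (φ x - ψ x) * (ℓ x - k) =
      (φ x * ℓ x - ψ x * ℓ x) - (k * φ x - k * ψ x) := fun x => by ring
  have i1 : Integrable (fun x => φ x * ℓ x - ψ x * ℓ x) P₀ := iφℓ.sub iψℓ
  have i2 : Integrable (fun x => k * φ x - k * ψ x) P₀ := (iφ.const_mul k).sub (iψ.const_mul k)
  have iD : Integrable (fun x => (φ x - ψ x) * (ℓ x - k)) P₀ := by
    simp only [hexp]
    exact i1.sub i2
  have hint : ∫ x, (φ x - ψ x) * (ℓ x - k) ∂P₀ =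
      (∫ x, φ x ∂P₁ - ∫ x, ψ x ∂P₁) - (k * ∫ x, φ x ∂P₀ - k * ∫ x, ψ x ∂P₀) := by
    simp only [hexp]
    rw [integral_sub i1 i2, integral_sub iφℓ iψℓ,
      integral_sub (iφ.const_mul k) (iψ.const_mul k), integral_const_mul, integral_const_mul, hφ, hψ]
  have hDi := integral_nonneg_of_ae hD0
  have hmul := mul_le_mul_of_nonneg_left hle hk
  refine ⟨by linarith, fun hge => ⟨?_, fun hkpos => ?_⟩⟩
  -- If `ψ` is as powerful as `φ`, the integral of the nonnegative product is also at most zero, so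
  -- `φ = ψ` wherever `ℓ ≠ k`. The same inequalities leave no room for a gap in size once `k > 0`.
  · have hz : ∫ x, (φ x - ψ x) * (ℓ x - k) ∂P₀ = 0 := le_antisymm (by linarith) hDi
    rw [integral_eq_zero_iff_of_nonneg_ae hD0 iD] at hz
    filter_upwards [hz] with x hx hne
    have := (mul_eq_zero.1 hx).resolve_right (sub_ne_zero.2 hne)
    linarith
  · have : k * ∫ x, ψ x ∂P₀ = k * ∫ x, φ x ∂P₀ := by linarith
    exact mul_left_cancel₀ hkpos.ne' this

/-- The threshold is the smallest `x` whose distribution function reaches `1 - α`. Right continuity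
bounds the mass above it, the left limit bounds the mass below it, and `α < 1` with `ℓ ≥ 0` keeps it
nonnegative. -/
lemma exists_quantile {Ω : Type*} [MeasurableSpace Ω] (P : Measure Ω) [IsProbabilityMeasure P]
    {ℓ : Ω → ℝ} (hℓ : Measurable ℓ) (h0 : ∀ x, 0 ≤ ℓ x) {α : ℝ} (hα : α ∈ Set.Ioo (0 : ℝ) 1) :
    ∃ k : ℝ, 0 ≤ k ∧ P.real {x | k < ℓ x} ≤ α ∧ α ≤ P.real {x | k ≤ ℓ x} := by
  set μ := P.map ℓ with hμ
  have : IsProbabilityMeasure μ := Measure.isProbabilityMeasure_map hℓ.aemeasurable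
  set F := ProbabilityTheory.cdf μ with hF
  have hFr : ∀ x, F x = μ.real (Set.Iic x) := fun x => ProbabilityTheory.cdf_eq_real μ x
  have hneg : ∀ x < 0, F x = 0 := by
    intro x hx
    rw [hFr, hμ, map_measureReal_apply hℓ measurableSet_Iic]
    have : ℓ ⁻¹' Set.Iic x = ∅ := by
      ext y; simpa using hx.trans_le (h0 y)
    rw [this, measureReal_empty]
  set S : Set ℝ := {x | 1 - α ≤ F x} with hS
  have hSne : S.Nonempty := by
    have h1 : ∀ᶠ x in Filter.atTop, 1 - α < F x :=
      (ProbabilityTheory.tendsto_cdf_atTop μ).eventually (lt_mem_nhds (by linarith [hα.1]))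
    obtain ⟨x, hx⟩ := h1.exists
    exact ⟨x, hx.le⟩
  have hlb : ∀ x ∈ S, 0 ≤ x := by
    intro x hx
    by_contra h
    have h1 : 1 - α ≤ F x := hx
    rw [hneg x (not_le.1 h)] at h1
    linarith [hα.2]
  have hbdd : BddBelow S := ⟨0, hlb⟩
  set k := sInf S with hkdef
  have hright : 1 - α ≤ F k := by
    have hc : Filter.Tendsto F (nhdsWithin k (Set.Ioi k)) (nhds (F k)) :=
      ((F.right_continuous k).mono Set.Ioi_subset_Ici_self)
    refine ge_of_tendsto hc ?_
    filter_upwards [self_mem_nhdsWithin] with y hy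
    obtain ⟨x, hx, hxy⟩ := exists_lt_of_csInf_lt hSne hy
    exact le_trans hx (F.mono hxy.le)
  have hleft : μ.real (Set.Iio k) ≤ 1 - α := by
    have h1 : μ (Set.Iio k) = ENNReal.ofReal (Function.leftLim F k - 0) := by
      rw [← F.measure_Iio (ProbabilityTheory.tendsto_cdf_atBot μ) k, hF,
        ProbabilityTheory.measure_cdf]
    have h2 : Function.leftLim F k ≤ 1 - α := by
      refine le_of_tendsto (F.mono.tendsto_leftLim k) ?_
      filter_upwards [self_mem_nhdsWithin] with y hy
      by_contra h
      exact absurd (csInf_le hbdd (not_le.1 h).le) (not_le.2 hy)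
    rw [measureReal_def, h1, sub_zero]
    exact ENNReal.toReal_le_of_le_ofReal (by linarith [hα.2]) (ENNReal.ofReal_le_ofReal h2)
  refine ⟨k, le_csInf hSne hlb, ?_, ?_⟩
  · have h1 : {x | k < ℓ x} = (ℓ ⁻¹' Set.Iic k)ᶜ := by ext x; simp
    rw [h1, probReal_compl_eq_one_sub (hℓ measurableSet_Iic),
      ← map_measureReal_apply hℓ measurableSet_Iic, ← hμ, ← hFr]
    linarith
  · have h1 : {x | k ≤ ℓ x} = (ℓ ⁻¹' Set.Iio k)ᶜ := by ext x; simp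
    rw [h1, probReal_compl_eq_one_sub (hℓ measurableSet_Iio),
      ← map_measureReal_apply hℓ measurableSet_Iio, ← hμ]
    linarith

/-! ### Invariant tests based on the ratio -/

section

variable {g₀ g₁ : (Fin p → ℝ) → ℝ}

lemma lintegral_jointDensity {g : (Fin p → ℝ) → ℝ} (hg : IsDensity g) :
    ∫⁻ X : Fin n → Fin p → ℝ, jointDensity g X = 1 := by
  have h1 := isProbabilityMeasure_sampleLaw (n := n) hg
  have h2 := h1.measure_univ
  rwa [sampleLaw_zero_one hg, withDensity_apply _ MeasurableSet.univ, setLIntegral_univ] at h2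

lemma lintegral_sampleLaw {g : (Fin p → ℝ) → ℝ} (hg : IsDensity g)
    {F : (Fin n → Fin p → ℝ) → ℝ≥0∞} (hF : Measurable F) :
    ∫⁻ X, F X ∂(sampleLaw n g 0 1) = ∫⁻ X, F X * jointDensity g X := by
  rw [sampleLaw_zero_one hg,
    lintegral_withDensity_eq_lintegral_mul _ (measurable_jointDensity hg.measurable) hF]
  exact lintegral_congr fun X => mul_comm _ _

lemma lintegral_invariant_sampleLaw (hn : p < n) (hg₀ : IsDensity g₀) (hpos : ∀ x, 0 < g₀ x)
    (hg₁ : IsDensity g₁) {φ : (Fin n → Fin p → ℝ) → ℝ≥0∞} (hφ : Measurable φ)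
    (hinv : ∀ (a : Fin p → ℝ), ∀ T ∈ LT p, ∀ X, φ (act a T X) = φ X) :
    ∫⁻ X, φ X ∂(sampleLaw n g₁ 0 1) = ∫⁻ X, φ X * ratio g₁ g₀ X ∂(sampleLaw n g₀ 0 1) := by
  rw [lintegral_sampleLaw hg₁ hφ,
    lintegral_sampleLaw hg₀ (hφ.fun_mul (measurable_ratio hg₀.measurable hg₁.measurable)),
    ← (lintegral_invariant_mul_ratio hn hg₀.measurable hpos hg₁.measurable
      (by rw [lintegral_jointDensity hg₀]; exact ENNReal.one_ne_top)).1 φ hφ hinv]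

lemma sampleLaw_absolutelyContinuous (hg : IsDensity g₀) :
    sampleLaw n g₀ 0 1 ≪ volume := by
  rw [sampleLaw_zero_one hg]; exact withDensity_absolutelyContinuous _ _

lemma absolutelyContinuous_sampleLaw (hg : IsDensity g₀) (hpos : ∀ x, 0 < g₀ x) :
    volume ≪ sampleLaw n g₀ 0 1 := by
  rw [sampleLaw_zero_one hg]
  refine withDensity_absolutelyContinuous' (measurable_jointDensity hg.measurable).aemeasurable ?_
  exact Filter.Eventually.of_forall fun X =>
    (ENNReal.ofReal_pos.2 (Finset.prod_pos fun i _ => hpos _)).ne'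

lemma lintegral_ratio (hn : p < n) (hg₀ : IsDensity g₀) (hpos : ∀ x, 0 < g₀ x)
    (hg₁ : IsDensity g₁) :
    ∫⁻ X : Fin n → Fin p → ℝ, ratio g₁ g₀ X ∂(sampleLaw n g₀ 0 1) = 1 := by
  have h := lintegral_invariant_sampleLaw hn hg₀ hpos hg₁ (φ := fun _ => 1) measurable_const
    fun _ _ _ _ => rfl
  have := isProbabilityMeasure_sampleLaw (n := n) hg₁
  simp only [one_mul, lintegral_one, measure_univ] at h
  exact h.symm

lemma ae_ratio_ne_top (hn : p < n) (hg₀ : IsDensity g₀) (hpos : ∀ x, 0 < g₀ x)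
    (hg₁ : IsDensity g₁) : ∀ᵐ X ∂(sampleLaw n g₀ 0 1), ratio g₁ g₀ X ≠ ∞ := by
  have h := ae_lt_top (measurable_ratio (n := n) hg₀.measurable hg₁.measurable)
    (by rw [lintegral_ratio hn hg₀ hpos hg₁]; exact ENNReal.one_ne_top)
  filter_upwards [h] with X hX using hX.ne

lemma integrable_ratio (hn : p < n) (hg₀ : IsDensity g₀) (hpos : ∀ x, 0 < g₀ x)
    (hg₁ : IsDensity g₁) :
    Integrable (fun X => (ratio g₁ g₀ X).toReal) (sampleLaw n g₀ 0 1) :=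
  integrable_toReal_of_lintegral_ne_top
    (measurable_ratio hg₀.measurable hg₁.measurable).aemeasurable
    (by rw [lintegral_ratio hn hg₀ hpos hg₁]; exact ENNReal.one_ne_top)

lemma integral_invariant_eq (hn : p < n) (hg₀ : IsDensity g₀) (hpos : ∀ x, 0 < g₀ x)
    (hg₁ : IsDensity g₁) {ψ : (Fin n → Fin p → ℝ) → ℝ} (hψ : IsInvariantTest ψ) :
    ∫ X, ψ X ∂(sampleLaw n g₁ 0 1) =
      ∫ X, ψ X * (ratio g₁ g₀ X).toReal ∂(sampleLaw n g₀ 0 1) := by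
  have hr := measurable_ratio (n := n) hg₀.measurable hg₁.measurable
  have h0 : ∀ X, 0 ≤ ψ X := fun X => (hψ.mem_Icc X).1
  rw [integral_eq_lintegral_of_nonneg_ae (Filter.Eventually.of_forall h0)
      hψ.measurable.aestronglyMeasurable,
    integral_eq_lintegral_of_nonneg_ae
      (Filter.Eventually.of_forall fun X => mul_nonneg (h0 X) ENNReal.toReal_nonneg)
      (hψ.measurable.fun_mul hr.ennreal_toReal).aestronglyMeasurable,
    lintegral_invariant_sampleLaw hn hg₀ hpos hg₁ hψ.measurable.ennreal_ofReal
      fun a T hT X => by rw [hψ.invariant a T hT X]]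
  congr 1
  refine lintegral_congr_ae ?_
  filter_upwards [ae_ratio_ne_top hn hg₀ hpos hg₁] with X hX
  rw [ENNReal.ofReal_mul (h0 X), ENNReal.ofReal_toReal hX]

lemma ae_mem_criticalRegion_iff (hn : p < n) (hg₀ : IsDensity g₀) (hpos : ∀ x, 0 < g₀ x)
    (hg₁ : IsDensity g₁) {k : ℝ} (hk : 0 ≤ k) : ∀ᵐ X ∂(sampleLaw n g₀ 0 1),
      (X ∈ criticalRegion g₁ g₀ k ↔ k < (ratio g₁ g₀ X).toReal) ∧
      (X ∈ criticalBoundary g₁ g₀ k ↔ (ratio g₁ g₀ X).toReal = k) := by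
  filter_upwards [ae_ratio_ne_top hn hg₀ hpos hg₁,
    (sampleLaw_absolutelyContinuous hg₀).ae_le (ae_det_sampleCov_ne_zero hn)] with X h1 h2
  rw [mem_criticalRegion hg₀.measurable hg₁.measurable,
    mem_criticalBoundary hg₀.measurable hg₁.measurable]
  refine ⟨?_, ?_⟩
  · rw [ENNReal.ofReal_lt_iff_lt_toReal hk h1]
    exact and_iff_right h2
  · rw [and_iff_right h2]
    constructor
    · intro h; rw [h, ENNReal.toReal_ofReal hk]
    · intro h; rw [← h, ENNReal.ofReal_toReal h1]

/-- A ratio test is most powerful invariant at its own level, and most powerful invariant tests of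
that level agree with it off the boundary. -/
theorem isMostPowerfulInvariant_ratioTest (hn : p < n) (hg₀ : IsDensity g₀) (hpos : ∀ x, 0 < g₀ x)
    (hsph : IsSpherical g₀) (hg₁ : IsDensity g₁) {k γ α : ℝ} (hk : 0 ≤ k)
    (hγ : γ ∈ Set.Icc (0 : ℝ) 1) (hα : ∫ X, ratioTest g₁ g₀ k γ X ∂(sampleLaw n g₀ 0 1) = α) :
    (∀ (a : Fin p → ℝ) (B : Matrix (Fin p) (Fin p) ℝ), B.det ≠ 0 →
      ∫ X, ratioTest g₁ g₀ k γ X ∂(sampleLaw n g₀ a B) = α) ∧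
    IsMostPowerfulInvariant (n := n) g₁ g₀ α (ratioTest g₁ g₀ k γ) ∧
    ∀ ψ : (Fin n → Fin p → ℝ) → ℝ, IsMostPowerfulInvariant g₁ g₀ α ψ →
      (∀ᵐ X ∂(sampleLaw n g₀ 0 1), X ∉ criticalBoundary g₁ g₀ k → ψ X = ratioTest g₁ g₀ k γ X) ∧
      (0 < k → ∫ X, ψ X ∂(sampleLaw n g₀ 0 1) = α) := by
  have hP := isProbabilityMeasure_sampleLaw (n := n) hg₀
  have hinv : IsInvariantTest (n := n) (ratioTest g₁ g₀ k γ) :=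
    isInvariantTest_ratioTest (by omega) hg₀.measurable hg₁.measurable k hγ
  have hsize : ∀ (a : Fin p → ℝ) (B : Matrix (Fin p) (Fin p) ℝ), B.det ≠ 0 →
      ∫ X, ratioTest g₁ g₀ k γ X ∂(sampleLaw n g₀ a B) = α := fun a B hB => by
    -- Sphericity of the null density puts every nonsingular `B` in `altScales g₀`, so the composite
    -- null collapses to one law for invariant tests.
    rw [integral_sampleLaw_of_mem_altScales hg₀ hinv a ⟨hB, Or.inr hsph⟩, hα]
  have hae := ae_mem_criticalRegion_iff hn hg₀ hpos hg₁ hk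
  have hNP : ∀ ψ : (Fin n → Fin p → ℝ) → ℝ, IsInvariantTest ψ → HasLevel g₀ α ψ → _ :=
    fun ψ hψ hlev => neyman_pearson hk (integrable_ratio hn hg₀ hpos hg₁) hinv.measurable
      hψ.measurable hinv.mem_Icc hψ.mem_Icc (integral_invariant_eq hn hg₀ hpos hg₁ hinv)
      (integral_invariant_eq hn hg₀ hpos hg₁ hψ)
      (by
        filter_upwards [hae] with X hX h
        exact ratioTest_of_mem_region hg₀.measurable hg₁.measurable (hX.1.2 h))
      (by
        filter_upwards [hae] with X hX h
        exact ratioTest_of_notMem (fun h' => lt_asymm h (hX.1.1 h')) fun h' => h.ne (hX.2.1 h'))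
      (by rw [hα]; exact hlev 0 1 (by simp))
  have hlevel : HasLevel (n := n) g₀ α (ratioTest g₁ g₀ k γ) := fun a B hB => (hsize a B hB).le
  refine ⟨hsize, ⟨hinv, hlevel, fun ψ hψ hlev a B hB => ?_⟩, fun ψ hψ => ?_⟩
  · rw [integral_sampleLaw_of_mem_altScales hg₁ hψ a hB,
      integral_sampleLaw_of_mem_altScales hg₁ hinv a hB]
    exact (hNP ψ hψ hlev).1
  -- The ratio test competes against `ψ` at `(0, 1)`, which gives the reverse power inequality
  -- needed for the equality case.
  · obtain ⟨h1, h2⟩ := (hNP ψ hψ.isInvariantTest hψ.hasLevel).2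
      (hψ.power_le _ hinv hlevel 0 1 (one_mem_altScales g₁))
    refine ⟨?_, fun hk0 => (h2 hk0).trans hα⟩
    filter_upwards [h1, hae] with X hX hXb hb
    exact hX fun h => hb (hXb.2.2 h)

lemma exists_ratioTest_size (hn : p < n) (hg₀ : IsDensity g₀) (hpos : ∀ x, 0 < g₀ x)
    (hg₁ : IsDensity g₁) {α : ℝ} (hα : α ∈ Set.Ioo (0 : ℝ) 1) :
    ∃ k : ℝ, 0 ≤ k ∧ ((∀ x, 0 < g₁ x) → 0 < k) ∧
      (sampleLaw n g₀ 0 1 (criticalBoundary g₁ g₀ k) = 0 →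
        (sampleLaw n g₀ 0 1).real (criticalRegion g₁ g₀ k) = α) ∧
      ∃ γ ∈ Set.Icc (0 : ℝ) 1, ∫ X, ratioTest g₁ g₀ k γ X ∂(sampleLaw n g₀ 0 1) = α := by
  have hP := isProbabilityMeasure_sampleLaw (n := n) hg₀
  have hr := measurable_ratio (n := n) hg₀.measurable hg₁.measurable
  obtain ⟨k, hk, hgt, hge⟩ := exists_quantile (sampleLaw n g₀ 0 1) hr.ennreal_toReal
    (fun _ => ENNReal.toReal_nonneg) hα
  have hae := ae_mem_criticalRegion_iff hn hg₀ hpos hg₁ hk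
  set P := sampleLaw n g₀ 0 1 with hPdef
  have h1 : P.real (criticalRegion g₁ g₀ k) = P.real {X | k < (ratio g₁ g₀ X).toReal} := by
    refine measureReal_congr ?_
    filter_upwards [hae] with X hX using propext hX.1
  have h2 : P.real (criticalRegion g₁ g₀ k) + P.real (criticalBoundary g₁ g₀ k) =
      P.real {X | k ≤ (ratio g₁ g₀ X).toReal} := by
    rw [← measureReal_union (disjoint_criticalRegion_criticalBoundary hg₀.measurable
      hg₁.measurable k) (measurableSet_criticalBoundary hg₀.measurable hg₁.measurable k)]
    refine measureReal_congr ?_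
    filter_upwards [hae] with X hX
    refine propext ?_
    change (X ∈ criticalRegion g₁ g₀ k ∨ X ∈ criticalBoundary g₁ g₀ k) ↔ k ≤ _
    rw [hX.1, hX.2, le_iff_lt_or_eq, eq_comm]
  rw [← h1] at hgt
  rw [← h2] at hge
  refine ⟨k, hk, fun hpos₁ => ?_, fun h0 => ?_, ?_⟩
  -- With `g₁` positive the ratio is almost surely positive, so at `k = 0` the critical region would
  -- have probability `1 > α`.
  · refine hk.lt_of_ne fun hk0 => ?_
    have hfull : ∀ᵐ X ∂P, X ∈ criticalRegion g₁ g₀ k := by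
      have hI := (lintegral_invariant_mul_ratio (n := n) hn hg₀.measurable hpos hg₁.measurable
        (by rw [lintegral_jointDensity hg₀]; exact ENNReal.one_ne_top)).2
      filter_upwards [(sampleLaw_absolutelyContinuous hg₀).ae_le hI,
        (sampleLaw_absolutelyContinuous hg₀).ae_le (ae_det_sampleCov_ne_zero hn)] with X hX hX'
      rw [mem_criticalRegion hg₀.measurable hg₁.measurable, ← hk0, ENNReal.ofReal_zero]
      exact ⟨hX', ENNReal.div_pos (orbitIntegral_ne_zero hg₁.measurable hpos₁ X) hX⟩
    have : P.real (criticalRegion g₁ g₀ k) = 1 := by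
      have hu : criticalRegion g₁ g₀ k =ᵐ[P] Set.univ := Filter.eventuallyEq_univ.2 hfull
      rw [measureReal_congr hu, probReal_univ]
    linarith [hα.2]
  · rw [measureReal_def P (criticalBoundary g₁ g₀ k), h0, ENNReal.toReal_zero, add_zero] at hge
    exact le_antisymm hgt hge
  · simp only [integral_ratioTest hg₀.measurable hg₁.measurable]
    rcases (measureReal_nonneg (μ := P) (s := criticalBoundary g₁ g₀ k)).eq_or_lt with h0 | h0
    · rw [← h0] at hge ⊢
      exact ⟨0, by simp, by linarith⟩
    -- Randomization on the boundary fills the gap between the size of the region and `α`; the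
    -- quantile inequalities put this fraction in `[0, 1]`.
    · refine ⟨(α - P.real (criticalRegion g₁ g₀ k)) / P.real (criticalBoundary g₁ g₀ k),
        ⟨div_nonneg (by linarith) h0.le, (div_le_one h0).2 (by linarith)⟩, ?_⟩
      rw [div_mul_cancel₀ _ h0.ne']
      ring

end

end NormTest

end

/-! ### The main theorem. -/

theorem proposition3 {n p : ℕ} (hn : p < n) (f : ℝ → (Fin p → ℝ) → ℝ)
    (hf : ∀ θ, 0 ≤ θ → NormTest.IsDensity (f θ))
    (hf0 : ∀ x, f 0 x = NormTest.stdNormalDensity x)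
    (θ₁ : ℝ) (hθ₁ : 0 < θ₁) :
    -- every region `ratio > k` is the most powerful invariant one of its size, unique up to null sets
    (∀ k : ℝ, 0 < k → ∀ α : ℝ,
      α = (NormTest.sampleLaw n (f 0) 0 1).real (NormTest.criticalRegion (f θ₁) (f 0) k) →
        (∀ (a : Fin p → ℝ) (B : Matrix (Fin p) (Fin p) ℝ), B.det ≠ 0 →
          (NormTest.sampleLaw n (f 0) a B).real (NormTest.criticalRegion (f θ₁) (f 0) k) = α) ∧
        NormTest.IsMostPowerfulInvariant (n := n) (f θ₁) (f 0) α
          ((NormTest.criticalRegion (f θ₁) (f 0) k).indicator fun _ => 1) ∧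
        ∀ ψ : (Fin n → Fin p → ℝ) → ℝ,
          NormTest.IsMostPowerfulInvariant (f θ₁) (f 0) α ψ →
            ψ =ᵐ[MeasureTheory.volume]
              (NormTest.criticalRegion (f θ₁) (f 0) k).indicator fun _ => 1) ∧
    -- every level is attained by such a test, randomized on `ratio = k` if that set is not null
    (∀ α : ℝ, α ∈ Set.Ioo (0 : ℝ) 1 → ∃ k : ℝ, 0 ≤ k ∧ ((∀ x, 0 < f θ₁ x) → 0 < k) ∧
      ((NormTest.sampleLaw n (f 0) 0 1) (NormTest.criticalBoundary (f θ₁) (f 0) k) = 0 →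
        (NormTest.sampleLaw n (f 0) 0 1).real (NormTest.criticalRegion (f θ₁) (f 0) k) = α) ∧
      ∃ γ : ℝ, γ ∈ Set.Icc (0 : ℝ) 1 ∧
        (∀ (a : Fin p → ℝ) (B : Matrix (Fin p) (Fin p) ℝ), B.det ≠ 0 →
          ∫ X, NormTest.ratioTest (f θ₁) (f 0) k γ X ∂(NormTest.sampleLaw n (f 0) a B) = α) ∧
        NormTest.IsMostPowerfulInvariant (n := n) (f θ₁) (f 0) α
          (NormTest.ratioTest (f θ₁) (f 0) k γ) ∧
        ∀ ψ : (Fin n → Fin p → ℝ) → ℝ,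
          NormTest.IsMostPowerfulInvariant (f θ₁) (f 0) α ψ →
            ∀ᵐ X : Fin n → Fin p → ℝ, X ∉ NormTest.criticalBoundary (f θ₁) (f 0) k →
              ψ X = NormTest.ratioTest (f θ₁) (f 0) k γ X) := by
  have hg₀ := hf 0 le_rfl
  have hg₁ := hf θ₁ hθ₁.le
  have hf0' : f 0 = NormTest.stdNormalDensity := funext hf0
  have hpos : ∀ x, 0 < f 0 x := fun x => by rw [hf0 x]; exact NormTest.stdNormalDensity_pos x
  have hsph : NormTest.IsSpherical (f 0) := by
    rw [hf0']; exact NormTest.isSpherical_stdNormalDensity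
  have hP := NormTest.isProbabilityMeasure_sampleLaw (n := n) hg₀
  -- The normal density is positive, so sets null under the standard null law are Lebesgue null;
  -- this transfers uniqueness to Lebesgue measure.
  have hac := NormTest.absolutelyContinuous_sampleLaw (n := n) hg₀ hpos
  refine ⟨fun k hk α hα => ?_, fun α hα => ?_⟩
  · have hmr := NormTest.measurableSet_criticalRegion (n := n) hg₀.measurable hg₁.measurable k
    have hsize : ∫ X, NormTest.ratioTest (f θ₁) (f 0) k 0 X ∂(NormTest.sampleLaw n (f 0) 0 1) = α := by
      rw [NormTest.integral_ratioTest hg₀.measurable hg₁.measurable, hα]; ring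
    obtain ⟨h1, h2, h3⟩ := NormTest.isMostPowerfulInvariant_ratioTest hn hg₀ hpos hsph hg₁ hk.le
      (by simp) hsize
    refine ⟨fun a B hB => ?_, by rwa [NormTest.ratioTest_zero] at h2, fun ψ hψ => ?_⟩
    · rw [← h1 a B hB, NormTest.ratioTest_zero, integral_indicator_const _ hmr]
      simp
    · obtain ⟨h4, h5⟩ := h3 ψ hψ
      rw [← NormTest.ratioTest_zero]
      refine hac.ae_le ?_
      have hψt := hψ.isInvariantTest
      have hφt := h2.isInvariantTest
      have hint : ∀ {χ : (Fin n → Fin p → ℝ) → ℝ}, NormTest.IsInvariantTest χ →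
          Integrable χ (NormTest.sampleLaw n (f 0) 0 1) := fun h =>
        Integrable.of_bound h.measurable.aestronglyMeasurable 1
          (Filter.Eventually.of_forall fun X => by
            rw [Real.norm_of_nonneg (h.mem_Icc X).1]; exact (h.mem_Icc X).2)
      -- With `γ = 0` the ratio test vanishes on the boundary, so it lies almost surely below `ψ`
      -- everywhere. For `k > 0` the sizes agree, which forces equality on the boundary too.
      have hle : NormTest.ratioTest (f θ₁) (f 0) k 0
          ≤ᵐ[NormTest.sampleLaw n (f 0) 0 1] ψ := by
        filter_upwards [h4] with X hX
        by_cases hb : X ∈ NormTest.criticalBoundary (f θ₁) (f 0) k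
        · rw [NormTest.ratioTest_of_mem_boundary hg₀.measurable hg₁.measurable hb]
          exact (hψt.mem_Icc X).1
        · exact (hX hb).ge
      have heq := (integral_eq_iff_of_ae_le (hint hφt) (hint hψt) hle).1
        (hsize.trans (h5 hk).symm)
      exact heq.symm
  · obtain ⟨k, hk, hkpos, hnull, γ, hγ, hsize⟩ :=
      NormTest.exists_ratioTest_size hn hg₀ hpos hg₁ hα
    obtain ⟨h1, h2, h3⟩ := NormTest.isMostPowerfulInvariant_ratioTest hn hg₀ hpos hsph hg₁ hk
      hγ hsize
    exact ⟨k, hk, hkpos, hnull, γ, hγ, h1, h2, fun ψ hψ => hac.ae_le (h3 ψ hψ).1⟩
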